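/- Let $e(x)=e^{2\pi i x}$ and $\Gamma=\mathrm{SL}_2(\mathbb Z)$. Let $\mathcal D$ be a discriminant form, i.e. a finite abelian group with a quadratic form $q:\mathcal D\to\mathbb Q/\mathbb Z$ whose associated symmetric bilinear form $(\beta,\gamma)=q(\beta+\gamma)-q(\beta)-q(\gamma)$ is non-degenerate. Assume that its signature $\operatorname{sign}(\mathcal D)\in\mathbb Z/8\mathbb Z$, determined by $\sum_{\gamma\in\mathcal D}e(q(\gamma))=e(\operatorname{sign}(\mathcal D)/8)\sqrt{|\mathcal D|}$, is even. Let $\mathbb C[\mathcal D]$ be the complex vector space with basis $(e^\gamma)_{\gamma\in\mathcal D}$ and let $\langle\cdot,\cdot\rangle$ be the scalar product on it, linear in the first and antilinear in the second argument, for which this basis is orthonormal. Let $\rho$ be the Weil representation of $\Gamma$ on $\mathbb C[\mathcal D]$, determined by $$\rho\left(\begin{smallmatrix}1&1\\0&1\end{smallmatrix}\right)e^\gamma=e(q(\gamma))e^\gamma,\qquad \rho\left(\begin{smallmatrix}0&1\\-1&0\end{smallmatrix}\right)e^\gamma=\frac{e(\operatorname{sign}(\mathcal D)/8)}{\sqrt{|\mathcal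 D|}}\sum_{\beta\in\mathcal D}e((\gamma,\beta))e^\beta .$$ For $k\in\mathbb Z$ and a function $f:\mathbb H\to\mathbb C[\mathcal D]$ write $(f|_k[M])(z)=\det(M)^{k/2}(cz+d)^{-k}f\left(\frac{az+b}{cz+d}\right)$ for $M=\left(\begin{smallmatrix}a&b\\c&d\end{smallmatrix}\right)$ with $\det M>0$. Let $\mathrm S_k(\mathcal D)$ be the space of cusp forms of weight $k$ for $\rho$, i.e. of holomorphic $f:\mathbb H\to\mathbb C[\mathcal D]$ with $f|_k[M]=\rho(M)f$ for all $M\in\Gamma$ that are bounded on $\{\operatorname{Im}z\ge y\}$ for every $y>0$ and tend to $0$ as $\operatorname{Im}z\to\infty$. For a positive integer $l$ put $\alpha=\left(\begin{smallmatrix}l^2&0\\0&1\end{smallmatrix}\right)$ and $\rho(\alpha)^{-1}e^\gamma=e^{l\gamma}$, and for $\delta=A\alpha B\in\Gamma\alpha\Gamma$ with $A,B\in\Gamma$ put $\rho(\delta)^{-1}=\rho(B^{-1})\rho(\alpha)^{-1}\rho(A^{-1})$ (this does not depend on the choice of $A,B$). The Hecke operator $T(l^2)$ is $$T(l^2)f=l^{k-2}\sum_i\rho(\delta_i)^{-1}f|_k[\delta_i],\qquad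 \Gamma\alpha\Gamma=\bigsqcup_i\Gamma\delta_i .$$ For a positive integer $c$ let $\mathcal D^c=\{c\beta\mid\beta\in\mathcal D\}$ and $\mathcal D^{c*}=\{\gamma\in\mathcal D\mid c\,q(\alpha)+(\alpha,\gamma)=0\text{ for all }\alpha\in\mathcal D\text{ with }c\alpha=0\}$. For $\gamma,\mu\in\mathcal D$ and a finite set $S$ of primes let $\gamma_S^\mu\in\mathcal D$ be the element whose $p$-primary component is that of $\mu$ for $p\in S$ and that of $\gamma$ for all other primes $p$, and for a finite set $P$ of primes put $$v_{\gamma,\mu,P}=\sum_{S\subset P}(-1)^{|S|}e^{\gamma_S^\mu}.$$ Let $P$ be a finite set of primes and let $\gamma,\mu\in\mathcal D$ satisfy $\left(\prod_{p\in P}p\right)(\gamma-\mu)=0$ and $q(\gamma)=q(\mu)$. Assume that $\gamma,\mu\notin\mathcal D^p$ for all $p\in P$ and, if $2\in P$, also $\gamma,\mu\notin\mathcal D^{2*}$. Let $s\in\mathbb C$ and $f\in\mathrm S_k(\mathcal D)$, and assume that $$\prod_{p\in P}\left(\sum_{r=0}^\infty\frac{T(p^{2r})}{p^{rs}}\right)f$$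 converges, i.e. that the operator series, applied to $f$ one after the other in some order of the primes in $P$, converge pointwise on $\mathbb H$. Then $$\left\langle\prod_{p\in P}\left(\sum_{r=0}^\infty\frac{T(p^{2r})}{p^{rs}}\right)f,\;v_{\gamma,\mu,P}\right\rangle=\langle f,v_{\gamma,\mu,P}\rangle$$ as functions on $\mathbb H$. -/

import Mathlib

open scoped MatrixGroups

namespace VVHecke
open ModularGroup

set_option linter.unusedSectionVars false

noncomputable section

section Presentation

theorem fmod_natAbs_lt (a : ℤ) {c : ℤ} (hc : c ≠ 0) : (a.fmod c).natAbs < c.natAbs := by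
  rcases lt_or_gt_of_ne hc with h | h
  · have h1 : a.fmod c = -((-a).fmod (-c)) := by
      rw [Int.fmod_def, Int.fmod_def, Int.neg_fdiv_neg]; ring
    have h2 := Int.fmod_nonneg_of_pos (-a) (b := -c) (by omega)
    have h3 := Int.fmod_lt_of_pos (-a) (b := -c) (by omega)
    omega
  · have h2 := Int.fmod_nonneg_of_pos a h
    have h3 := Int.fmod_lt_of_pos a h
    omega

theorem S_mul_apply (A : SL(2, ℤ)) : (S * A) 0 0 = -A 1 0 ∧ (S * A) 0 1 = -A 1 1 ∧
    (S * A) 1 0 = A 0 0 ∧ (S * A) 1 1 = A 0 1 := by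
  simp [coe_S, Matrix.mul_apply, Fin.sum_univ_two]

theorem T_mul_apply (A : SL(2, ℤ)) : (T * A) 0 0 = A 0 0 + A 1 0 ∧ (T * A) 0 1 = A 0 1 + A 1 1 ∧
    (T * A) 1 0 = A 1 0 ∧ (T * A) 1 1 = A 1 1 := by
  simp [coe_T, Matrix.mul_apply, Fin.sum_univ_two]

theorem T_zpow_mul_apply (n : ℤ) (A : SL(2, ℤ)) : (T ^ n * A) 0 0 = A 0 0 + n * A 1 0 ∧
    (T ^ n * A) 1 0 = A 1 0 := by
  simp [coe_T_zpow, Matrix.mul_apply, Fin.sum_univ_two]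

/-- One step of the Euclidean algorithm on the first column. -/
def euclidStep (A : SL(2, ℤ)) : SL(2, ℤ) := S * (T ^ (-((A 0 0).fdiv (A 1 0))) * A)

theorem euclidStep_apply (A : SL(2, ℤ)) : (euclidStep A) 1 0 = (A 0 0).fmod (A 1 0) := by
  rw [euclidStep, (S_mul_apply _).2.2.1, (T_zpow_mul_apply _ _).1, Int.fmod_def]; ring

variable {G : Type*} [Group G]

/-- The word in `j` and `t` obtained by writing `A` as a word in `J = S⁻¹` and `T` through the
Euclidean algorithm. -/
def word (j t : G) (A : SL(2, ℤ)) : G :=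
  if h : A 1 0 = 0 then (if A 0 0 = 1 then 1 else j ^ 2) * t ^ (A 0 0 * A 0 1)
  else t ^ ((A 0 0).fdiv (A 1 0)) * (j * word j t (euclidStep A))
termination_by (A 1 0).natAbs
decreasing_by rw [euclidStep_apply]; exact fmod_natAbs_lt _ h

theorem word_zero (j t : G) {A : SL(2, ℤ)} (h : A 1 0 = 0) :
    word j t A = (if A 0 0 = 1 then 1 else j ^ 2) * t ^ (A 0 0 * A 0 1) := by
  rw [word, dif_pos h]

theorem word_ne (j t : G) {A : SL(2, ℤ)} (h : A 1 0 ≠ 0) :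
    word j t A = t ^ ((A 0 0).fdiv (A 1 0)) * (j * word j t (euclidStep A)) := by
  rw [word, dif_neg h]

theorem diag_of_zero {A : SL(2, ℤ)} (h : A 1 0 = 0) :
    (A 0 0 = 1 ∧ A 1 1 = 1) ∨ (A 0 0 = -1 ∧ A 1 1 = -1) := by
  have := A.det_coe
  rw [Matrix.det_fin_two, h, mul_zero, sub_zero] at this
  exact Int.mul_eq_one_iff_eq_one_or_neg_one.mp this

variable {j t : G}

theorem word_T (hc : Commute (j ^ 2) t) (A : SL(2, ℤ)) : word j t (T * A) = t * word j t A := by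
  obtain ⟨h00, h01, h10, h11⟩ := T_mul_apply A
  by_cases h : A 1 0 = 0
  · rw [word_zero j t h, word_zero j t (h10.trans h), h00, h01, h, add_zero]
    rcases diag_of_zero h with ⟨h1, h2⟩ | ⟨h1, h2⟩
    · rw [h1, h2]; simp [zpow_add, (Commute.refl t).zpow_right _ |>.eq]
    · rw [h1, h2]
      have e : (-1 : ℤ) * (A 0 1 + -1) = 1 + -1 * A 0 1 := by ring
      rw [e, zpow_add, zpow_one, if_neg (by decide), ← mul_assoc, hc.eq, mul_assoc]
  · have h' : (T * A) 1 0 ≠ 0 := by rwa [h10]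
    have e : euclidStep (T * A) = euclidStep A := by
      rw [euclidStep, euclidStep, h00, h10]
      have := Int.add_mul_fdiv_right (A 0 0) 1 h
      rw [one_mul] at this
      rw [this, ← mul_assoc (T ^ _), neg_add, zpow_add, zpow_neg_one, inv_mul_cancel_right]
    rw [word_ne j t h, word_ne j t h', e, h00, h10]
    have := Int.add_mul_fdiv_right (A 0 0) 1 h
    rw [one_mul] at this
    rw [this, add_comm, zpow_add, zpow_one, mul_assoc]

theorem neg_apply (A : SL(2, ℤ)) (a b : Fin 2) : (-A) a b = -A a b := by simp

theorem word_neg (h4 : j ^ 4 = 1) (hc : Commute (j ^ 2) t) :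
    ∀ (n : ℕ) (A : SL(2, ℤ)), (A 1 0).natAbs = n → word j t (-A) = j ^ 2 * word j t A := by
  intro n
  induction n using Nat.strong_induction_on with
  | _ n ih =>
    intro A hn
    by_cases h : A 1 0 = 0
    · have h' : (-A) 1 0 = 0 := by rw [neg_apply, h, neg_zero]
      rw [word_zero j t h, word_zero j t h', neg_apply, neg_apply, neg_mul_neg]
      rcases diag_of_zero h with ⟨h1, h2⟩ | ⟨h1, h2⟩
      · rw [h1]; simp
      · rw [h1, neg_neg, if_pos rfl, if_neg (by decide), ← mul_assoc, ← pow_add, h4]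
    · have h' : (-A) 1 0 ≠ 0 := by rw [neg_apply]; omega
      have e : euclidStep (-A) = -euclidStep A := by
        rw [euclidStep, euclidStep, neg_apply, neg_apply, Int.neg_fdiv_neg]
        simp
      rw [word_ne j t h, word_ne j t h', e, neg_apply, neg_apply, Int.neg_fdiv_neg,
        ih _ (by rw [← hn, euclidStep_apply]; exact fmod_natAbs_lt _ h) _ rfl]
      have h1 : j * j ^ 2 = j ^ 2 * j := by rw [← pow_succ, ← pow_succ']
      have h2 := (hc.zpow_right ((A 0 0).fdiv (A 1 0))).eq
      rw [← mul_assoc j, h1, ← mul_assoc (j ^ 2), h2]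
      simp only [mul_assoc]

theorem S_mul_S_mul (A : SL(2, ℤ)) : S * (S * A) = -A := by
  rw [← mul_assoc]
  have : S * S = -1 := by decide
  rw [this, neg_one_mul]

theorem word_S_direct (A : SL(2, ℤ)) (h : A 1 0 ≠ 0) (h0 : (A 0 0).fdiv (A 1 0) = 0) :
    word j t (S * A) = j⁻¹ * word j t A := by
  have : euclidStep A = S * A := by rw [euclidStep, h0]; simp
  rw [word_ne j t h, this, h0, zpow_zero, one_mul, inv_mul_cancel_left]

theorem word_S_swap (h4 : j ^ 4 = 1) (hc : Commute (j ^ 2) t) (A : SL(2, ℤ))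
    (h : word j t (S * (S * A)) = j⁻¹ * word j t (S * A)) :
    word j t (S * A) = j⁻¹ * word j t A := by
  rw [S_mul_S_mul, word_neg h4 hc _ A rfl] at h
  have h' : word j t (S * A) = j * (j ^ 2 * word j t A) := by rw [h, mul_inv_cancel_left]
  rw [h', ← mul_assoc, ← pow_succ', eq_inv_mul_iff_mul_eq, ← mul_assoc, ← pow_succ', h4, one_mul]

theorem fdiv_eq_zero {a c : ℤ} (h : (0 ≤ a ∧ a < c) ∨ (a ≤ 0 ∧ c < a)) : a.fdiv c = 0 := by
  rcases h with h | h
  · exact Int.fdiv_eq_zero_of_lt h.1 h.2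
  · rw [← Int.neg_fdiv_neg]; exact Int.fdiv_eq_zero_of_lt (by omega) (by omega)

theorem word_S (h4 : j ^ 4 = 1) (h3 : (j * t) ^ 3 = 1) (hc : Commute (j ^ 2) t) :
    ∀ (n : ℕ) (A : SL(2, ℤ)), (A 0 0).natAbs + (A 1 0).natAbs = n →
      word j t (S * A) = j⁻¹ * word j t A := by
  have rel : t * (j⁻¹ * (t * (j⁻¹ * t))) = j⁻¹ := by
    have e : j⁻¹ = j ^ 2 * j := by
      rw [← pow_succ]; exact inv_eq_of_mul_eq_one_right (by rw [← pow_succ']; exact h4)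
    have e2 : t * (j * (t * (j * t))) = j⁻¹ := by
      apply eq_inv_of_mul_eq_one_right
      rw [← h3]; simp only [pow_succ, pow_zero, one_mul, mul_assoc]
    have hj : Commute (j ^ 2) j := (Commute.refl j).pow_left 2
    calc t * (j⁻¹ * (t * (j⁻¹ * t))) = t * (j ^ 2 * (j * (t * (j ^ 2 * (j * t))))) := by
          rw [e]; simp only [mul_assoc]
      _ = j ^ 2 * (j ^ 2 * (t * (j * (t * (j * t))))) := by
          have k1 : t * (j ^ 2 * (j * t)) = j ^ 2 * (t * (j * t)) := by
            rw [← mul_assoc, ← hc.eq, mul_assoc]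
          rw [k1, ← mul_assoc j (j ^ 2), ← hj.eq, mul_assoc, ← mul_assoc t (j ^ 2), ← hc.eq,
            mul_assoc, ← mul_assoc t (j ^ 2), ← hc.eq, mul_assoc]
      _ = j⁻¹ := by rw [e2, ← mul_assoc, ← pow_add, h4, one_mul]
  intro n
  induction n using Nat.strong_induction_on with
  | _ n ih =>
    have opp : ∀ A : SL(2, ℤ), (A 0 0).natAbs + (A 1 0).natAbs = n →
        (0 < A 0 0 ∧ A 1 0 < 0 ∨ A 0 0 < 0 ∧ 0 < A 1 0) → (A 0 0).natAbs ≤ (A 1 0).natAbs →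
        word j t (S * A) = j⁻¹ * word j t A := by
      intro A hn hs hle
      have hT := T_mul_apply A
      have hST := S_mul_apply (T * A)
      have hTST := T_mul_apply (S * (T * A))
      have e : S * A = T * (S * (T * (S * (T * A)))) := by
        simp only [← mul_assoc]; congr 1; decide
      rw [e, word_T hc, ih ((A 0 0).natAbs + (A 0 0 + A 1 0).natAbs) (by omega)
        (T * (S * (T * A))) (by rw [hTST.1, hTST.2.2.1, hST.1, hST.2.2.1, hT.1, hT.2.2.1]; omega),
        word_T hc, word_S_direct (T * A) (by rw [hT.2.2.1]; omega)
        (by rw [hT.1, hT.2.2.1]; apply fdiv_eq_zero; omega), word_T hc]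
      calc _ = t * (j⁻¹ * (t * (j⁻¹ * t))) * word j t A := by simp only [mul_assoc]
        _ = _ := by rw [rel]
    intro A hn
    have hS := S_mul_apply A
    have hdet := A.det_coe
    rw [Matrix.det_fin_two] at hdet
    by_cases hc0 : A 1 0 = 0
    · apply word_S_swap h4 hc
      have : A 0 0 ≠ 0 := by rintro h; rw [h, hc0] at hdet; simp at hdet
      apply word_S_direct
      · rw [hS.2.2.1]; exact this
      · rw [hS.1, hc0, neg_zero, Int.zero_fdiv]
    · by_cases hd : (0 ≤ A 0 0 ∧ A 0 0 < A 1 0) ∨ (A 0 0 ≤ 0 ∧ A 1 0 < A 0 0)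
      · exact word_S_direct A hc0 (fdiv_eq_zero hd)
      · by_cases ho : (0 < A 0 0 ∧ A 1 0 < 0 ∨ A 0 0 < 0 ∧ 0 < A 1 0)
        · by_cases hle : (A 0 0).natAbs ≤ (A 1 0).natAbs
          · exact opp A hn ho hle
          · apply word_S_swap h4 hc
            apply word_S_direct
            · rw [hS.2.2.1]; omega
            · rw [hS.1, hS.2.2.1]; apply fdiv_eq_zero; omega
        · apply word_S_swap h4 hc
          apply opp
          · rw [hS.1, hS.2.2.1]; omega
          · rw [hS.1, hS.2.2.1]; omega
          · rw [hS.1, hS.2.2.1]; omega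

/-- `SL(2, ℤ)` is generated by `J = S⁻¹` and `T` with the relations `J ^ 4 = 1`, `(J T) ^ 3 = 1`
and `J ^ 2` central: elements of a group with these relations define a homomorphism. -/
def liftSL2Z (j t : G) (h4 : j ^ 4 = 1) (h3 : (j * t) ^ 3 = 1) (hc : Commute (j ^ 2) t) :
    SL(2, ℤ) →* G where
  toFun := word j t
  map_one' := by rw [word_zero j t (by simp)]; simp
  map_mul' := by
    have key : ∀ A ∈ Subgroup.closure ({S, T} : Set SL(2, ℤ)),
        ∀ B, word j t (A * B) = word j t A * word j t B := by
      have h1 : word j t 1 = 1 := by rw [word_zero j t (by simp)]; simp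
      have hS : ∀ B, word j t (S * B) = j⁻¹ * word j t B := fun B => word_S h4 h3 hc _ B rfl
      have hT : ∀ B, word j t (T * B) = t * word j t B := word_T hc
      intro A hA
      induction hA using Subgroup.closure_induction with
      | mem x hx =>
        intro B
        rcases hx with rfl | rfl
        · have := hS 1
          rw [mul_one, h1, mul_one] at this
          rw [hS, this]
        · have := hT 1
          rw [mul_one, h1, mul_one] at this
          rw [hT, this]
      | one => intro B; rw [one_mul, h1, one_mul]
      | mul x y _ _ hx hy => intro B; rw [mul_assoc, hx, hy, hx, mul_assoc]
      | inv x _ hx =>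
        intro B
        have a := hx (x⁻¹ * B)
        have b := hx x⁻¹
        rw [mul_inv_cancel_left] at a
        rw [mul_inv_cancel, h1] at b
        rw [a, ← mul_assoc, eq_inv_of_mul_eq_one_right b.symm]; simp
    intro A B
    exact key A (by rw [SpecialLinearGroup.SL2Z_generators]; trivial) B

end Presentation

section DiscriminantForms

/-- `x ↦ e ^ {2 π i x}` on `ℚ` has period `1`. -/
theorem exp_periodic :
    Function.Periodic (fun x : ℚ => Complex.exp (2 * Real.pi * Complex.I * (x : ℂ))) 1 := by
  intro x
  have : (2 * Real.pi * Complex.I * ((x + 1 : ℚ) : ℂ)) =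
      2 * Real.pi * Complex.I * (x : ℂ) + 2 * Real.pi * Complex.I := by push_cast; ring
  simp only [this]
  exact Complex.exp_periodic _

/-- `e(x) = e ^ {2 π i x}` for `x ∈ ℚ / ℤ`. -/
def e (x : AddCircle (1 : ℚ)) : ℂ := exp_periodic.lift x

theorem e_coe (x : ℚ) : e (x : AddCircle (1 : ℚ)) = Complex.exp (2 * Real.pi * Complex.I * x) :=
  rfl

theorem e_add (x y : AddCircle (1 : ℚ)) : e (x + y) = e x * e y := by
  induction x using QuotientAddGroup.induction_on with | _ x => ?_
  induction y using QuotientAddGroup.induction_on with | _ y => ?_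
  rw [← QuotientAddGroup.mk_add, e_coe, e_coe, e_coe, ← Complex.exp_add]
  congr 1; push_cast; ring

theorem e_zero : e 0 = 1 := by
  have := e_coe 0
  simpa using this

theorem e_eq_one {x : AddCircle (1 : ℚ)} (h : e x = 1) : x = 0 := by
  induction x using QuotientAddGroup.induction_on with | _ x => ?_
  rw [e_coe, Complex.exp_eq_one_iff] at h
  obtain ⟨n, hn⟩ := h
  have h2 : (2 * Real.pi * Complex.I : ℂ) ≠ 0 := Complex.two_pi_I_ne_zero
  have h3 : (x : ℂ) = n := by
    rw [mul_comm (n : ℂ)] at hn; exact mul_left_cancel₀ h2 hn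
  have h4 : x = n := by exact_mod_cast h3
  rw [QuotientAddGroup.eq_zero_iff, AddSubgroup.mem_zmultiples_iff]
  exact ⟨n, by simp [h4]⟩

/-- A discriminant form: a (finite) abelian group with a quadratic form `q : D → ℚ / ℤ` whose
associated bilinear form `(β, γ) = q (β + γ) - q β - q γ` is non-degenerate. -/
structure DiscriminantForm (D : Type*) [AddCommGroup D] where
  q : QuadraticMap ℤ D (AddCircle (1 : ℚ))
  nondegenerate : ∀ x : D, (∀ y : D, QuadraticMap.polar q x y = 0) → x = 0

namespace DiscriminantForm

variable {D : Type*} [AddCommGroup D] (𝒟 : DiscriminantForm D)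

/-- The bilinear form `(β, γ) = q (β + γ) - q β - q γ`. -/
def bil (x y : D) : AddCircle (1 : ℚ) := QuadraticMap.polar 𝒟.q x y

theorem bil_comm (x y : D) : 𝒟.bil x y = 𝒟.bil y x := QuadraticMap.polar_comm _ _ _

theorem bil_add_left (x y z : D) : 𝒟.bil (x + y) z = 𝒟.bil x z + 𝒟.bil y z :=
  QuadraticMap.polar_add_left _ _ _ _

theorem bil_add_right (x y z : D) : 𝒟.bil x (y + z) = 𝒟.bil x y + 𝒟.bil x z :=
  QuadraticMap.polar_add_right _ _ _ _

theorem q_add (x y : D) : 𝒟.q (x + y) = 𝒟.q x + 𝒟.q y + 𝒟.bil x y := by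
  rw [bil, QuadraticMap.polar]; abel

theorem q_neg (x : D) : 𝒟.q (-x) = 𝒟.q x := QuadraticMap.map_neg _ _

/-- The signature of a discriminant form, an integer modulo `8`, defined through the Gauss sum
`∑ e(q(γ)) = e(sign / 8) √|D|`. -/
def HasSignature [Fintype D] (sgn : ℤ) : Prop :=
  ∑ γ : D, e (𝒟.q γ) =
    Complex.exp (2 * Real.pi * Complex.I * (sgn / 8)) * (Real.sqrt (Fintype.card D) : ℂ)

/-- The subgroup `D^c = c D`, as a set. -/
def mulImage (D : Type*) [AddCommGroup D] (c : ℕ) : Set D := {γ | ∃ x : D, c • x = γ}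

/-- The coset `D^{c*} = {γ | c q(α) + (α, γ) = 0 for all α with c α = 0}` of `D^c`. -/
def starCoset (c : ℕ) : Set D := {γ | ∀ α : D, c • α = 0 → c • 𝒟.q α + 𝒟.bil α γ = 0}

end DiscriminantForm

end DiscriminantForms

section WeilRepresentation

variable {D : Type*} [AddCommGroup D] [Fintype D] [DecidableEq D] (𝒟 : DiscriminantForm D)

open DiscriminantForm

/-- The operator `e^γ ↦ e(n q(γ)) e^γ` of `T ^ n`, `n = ±1`, on `ℂ[D]`; elements of `ℂ[D]` are
written as their coefficient functions `D → ℂ`, so that `e^γ = Pi.single γ 1`. -/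
def weilT (n : ℤ) : Module.End ℂ (D → ℂ) where
  toFun f γ := e (n • 𝒟.q γ) * f γ
  map_add' f g := by ext γ; simp [mul_add]
  map_smul' c f := by ext γ; simp [mul_left_comm]

/-- The operator `e^γ ↦ e(sign / 8) / √|D| ∑_β e((γ, β)) e^β` of `J`. -/
def weilJ (sgn : ℤ) : Module.End ℂ (D → ℂ) where
  toFun f β := Complex.exp (2 * Real.pi * Complex.I * (sgn / 8)) / (Real.sqrt (Fintype.card D) : ℂ) *
    ∑ γ : D, f γ * e (𝒟.bil γ β)
  map_add' f g := by ext γ; simp [add_mul, Finset.sum_add_distrib, mul_add]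
  map_smul' c f := by
    ext γ; simp only [Pi.smul_apply, smul_eq_mul, RingHom.id_apply, mul_assoc, ← Finset.mul_sum]
    rw [mul_left_comm c]

theorem sum_e_bil (x : D) :
    ∑ δ : D, e (𝒟.bil δ x) = if x = 0 then (Fintype.card D : ℂ) else 0 := by
  let ψ : AddChar D ℂ :=
    { toFun := fun δ => e (𝒟.bil δ x)
      map_zero_eq_one' := by
        have : 𝒟.bil 0 x = 0 := QuadraticMap.polar_zero_left _ _
        rw [this, e_zero]
      map_add_eq_mul' := fun a b => by rw [bil_add_left, e_add] }
  have h := AddChar.sum_eq_ite ψ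
  have h' : ψ = 0 ↔ x = 0 := by
    constructor
    · intro hψ
      apply 𝒟.nondegenerate
      intro y
      apply e_eq_one
      have : ψ y = 1 := by rw [hψ]; rfl
      rw [← bil, bil_comm]; exact this
    · rintro rfl
      ext δ
      have : 𝒟.bil δ 0 = 0 := QuadraticMap.polar_zero_right _ _
      change e (𝒟.bil δ 0) = 1
      rw [this, e_zero]
  rw [show ∑ δ : D, e (𝒟.bil δ x) = ∑ δ : D, ψ δ from rfl, h]
  simp only [h']

theorem sqrt_card_sq :
    (Real.sqrt (Fintype.card D) : ℂ) * (Real.sqrt (Fintype.card D) : ℂ) = (Fintype.card D : ℂ) := by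
  rw [← Complex.ofReal_mul, Real.mul_self_sqrt (by positivity)]; simp

theorem sqrt_card_ne : (Real.sqrt (Fintype.card D) : ℂ) ≠ 0 := by
  intro h
  have := sqrt_card_sq (D := D)
  rw [h, zero_mul] at this
  exact Nat.cast_ne_zero.2 (Fintype.card_ne_zero (α := D)) this.symm

theorem weilJ_sq (sgn : ℤ) (f : D → ℂ) (β : D) : weilJ 𝒟 sgn (weilJ 𝒟 sgn f) β =
    Complex.exp (2 * Real.pi * Complex.I * (sgn / 8)) ^ 2 * f (-β) := by
  simp only [weilJ, LinearMap.coe_mk, AddHom.coe_mk]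
  set ζ := Complex.exp (2 * Real.pi * Complex.I * (sgn / 8))
  set R := (Real.sqrt (Fintype.card D) : ℂ) with hR
  have hR2 : R * R = (Fintype.card D : ℂ) := sqrt_card_sq
  have hR0 : R ≠ 0 := sqrt_card_ne
  have key : ∑ x : D, (∑ γ : D, f γ * e (𝒟.bil γ x)) * e (𝒟.bil x β) = R * R * f (-β) := by
    simp only [Finset.sum_mul]
    rw [Finset.sum_comm]
    have : ∀ γ : D, ∑ x : D, f γ * e (𝒟.bil γ x) * e (𝒟.bil x β) =
        f γ * if γ = -β then R * R else 0 := by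
      intro γ
      rw [hR2]
      have := sum_e_bil 𝒟 (γ + β)
      simp only [add_eq_zero_iff_eq_neg] at this
      rw [← this, Finset.mul_sum]
      refine Finset.sum_congr rfl fun x _ => ?_
      rw [bil_add_right, e_add, 𝒟.bil_comm γ x, mul_assoc]
    simp only [this]
    simp [mul_comm]
  have : ∀ x : D, ζ / R * (∑ γ : D, f γ * e (𝒟.bil γ x)) * e (𝒟.bil x β) =
      ζ / R * ((∑ γ : D, f γ * e (𝒟.bil γ x)) * e (𝒟.bil x β)) := fun x => mul_assoc _ _ _
  simp only [this, ← Finset.mul_sum, key]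
  field_simp

theorem exp_sgn_pow_four {sgn : ℤ} (h : Even sgn) :
    Complex.exp (2 * Real.pi * Complex.I * (sgn / 8)) ^ 4 = 1 := by
  obtain ⟨m, rfl⟩ := h
  rw [← Complex.exp_nat_mul, Complex.exp_eq_one_iff]
  exact ⟨m, by push_cast; ring⟩

theorem weilJ_pow_four {sgn : ℤ} (h : Even sgn) : weilJ 𝒟 sgn ^ 4 = 1 := by
  refine LinearMap.ext fun f => funext fun β => ?_
  change weilJ 𝒟 sgn (weilJ 𝒟 sgn (weilJ 𝒟 sgn (weilJ 𝒟 sgn f))) β = f β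
  rw [weilJ_sq, weilJ_sq, neg_neg, ← mul_assoc, ← pow_add, exp_sgn_pow_four h, one_mul]

theorem weilT_mul (m n : ℤ) : weilT 𝒟 m * weilT 𝒟 n = weilT 𝒟 (m + n) := by
  refine LinearMap.ext fun f => funext fun β => ?_
  change e (m • 𝒟.q β) * (e (n • 𝒟.q β) * f β) = e ((m + n) • 𝒟.q β) * f β
  rw [add_smul, e_add, mul_assoc]

theorem weilT_zero : weilT 𝒟 0 = 1 := by
  refine LinearMap.ext fun f => funext fun β => ?_
  change e ((0 : ℤ) • 𝒟.q β) * f β = f β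
  rw [zero_smul, e_zero, one_mul]

/-- `T J T J T = J² J`, written out. -/
theorem weilJ_T_J {sgn : ℤ} (hs : 𝒟.HasSignature sgn) (f : D → ℂ) (β : D) :
    weilT 𝒟 1 (weilJ 𝒟 sgn (weilT 𝒟 1 (weilJ 𝒟 sgn (weilT 𝒟 1 f)))) β =
      Complex.exp (2 * Real.pi * Complex.I * (sgn / 8)) ^ 2 * weilJ 𝒟 sgn f (-β) := by
  simp only [weilJ, weilT, LinearMap.coe_mk, AddHom.coe_mk, one_smul]
  unfold HasSignature at hs
  set ζ := Complex.exp (2 * Real.pi * Complex.I * (sgn / 8))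
  set R := (Real.sqrt (Fintype.card D) : ℂ) with hR
  have hR0 : R ≠ 0 := sqrt_card_ne
  have shift : ∀ x : D, ∑ δ : D, e (𝒟.q δ) * e (𝒟.bil δ x) * e (𝒟.q x) = ζ * R := by
    intro x
    rw [← hs, ← Equiv.sum_comp (Equiv.addRight x) fun γ => e (𝒟.q γ)]
    refine Finset.sum_congr rfl fun δ _ => ?_
    rw [Equiv.coe_addRight, q_add, e_add, e_add]; ring
  have key : e (𝒟.q β) * ∑ δ : D, e (𝒟.q δ) * (∑ γ : D, e (𝒟.q γ) * f γ * e (𝒟.bil γ δ)) *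
      e (𝒟.bil δ β) = ζ * R * ∑ γ : D, f γ * e (𝒟.bil γ (-β)) := by
    simp only [Finset.mul_sum, Finset.sum_mul]
    rw [Finset.sum_comm]
    refine Finset.sum_congr rfl fun γ _ => ?_
    rw [← shift (γ + β), Finset.sum_mul]
    refine Finset.sum_congr rfl fun δ _ => ?_
    rw [bil_add_right, q_add, e_add, e_add, e_add, 𝒟.bil_comm δ γ]
    have h1 : e (𝒟.bil γ β) * e (𝒟.bil γ (-β)) = 1 := by
      rw [← e_add, ← bil_add_right, add_neg_cancel]
      have : 𝒟.bil γ 0 = 0 := QuadraticMap.polar_zero_right _ _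
      rw [this, e_zero]
    linear_combination (-(e (𝒟.q β) * e (𝒟.q δ) * e (𝒟.q γ) * f γ * e (𝒟.bil γ δ) *
      e (𝒟.bil δ β))) * h1
  have : ∀ δ : D, e (𝒟.q δ) * (ζ / R * ∑ γ : D, e (𝒟.q γ) * f γ * e (𝒟.bil γ δ)) *
      e (𝒟.bil δ β) = ζ / R * (e (𝒟.q δ) * (∑ γ : D, e (𝒟.q γ) * f γ * e (𝒟.bil γ δ)) *
      e (𝒟.bil δ β)) := fun δ => by ring
  simp only [this, ← Finset.mul_sum]
  have e1 : ∀ X : ℂ, e (𝒟.q β) * (ζ / R * (ζ / R * X)) = ζ / R * (ζ / R) * (e (𝒟.q β) * X) :=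
    fun X => by ring
  rw [e1, key]
  field_simp

/-- `weilT` as an invertible operator. -/
def weilTUnit : (Module.End ℂ (D → ℂ))ˣ where
  val := weilT 𝒟 1
  inv := weilT 𝒟 (-1)
  val_inv := by rw [weilT_mul, add_neg_cancel, weilT_zero]
  inv_val := by rw [weilT_mul, neg_add_cancel, weilT_zero]

/-- `weilJ` as an invertible operator. -/
def weilJUnit {sgn : ℤ} (h : Even sgn) : (Module.End ℂ (D → ℂ))ˣ where
  val := weilJ 𝒟 sgn
  inv := weilJ 𝒟 sgn ^ 3
  val_inv := by rw [← pow_succ', weilJ_pow_four 𝒟 h]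
  inv_val := by rw [← pow_succ, weilJ_pow_four 𝒟 h]

/-- The Weil representation of `SL(2, ℤ)` on `ℂ[D]` for a discriminant form of even signature: the
homomorphism with `T ↦ (e^γ ↦ e(q(γ)) e^γ)` and
`J ↦ (e^γ ↦ e(sign / 8) / √|D| ∑_β e((γ, β)) e^β)`, see `weilRep_T` and `weilRep_J`. -/
def weilRep {sgn : ℤ} (hs : 𝒟.HasSignature sgn) (heven : Even sgn) :
    SL(2, ℤ) →* Module.End ℂ (D → ℂ) :=
  (Units.coeHom _).comp <| liftSL2Z (weilJUnit 𝒟 heven) (weilTUnit 𝒟)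
    (by ext1; exact weilJ_pow_four 𝒟 heven)
    (by
      have h4 := weilJ_pow_four 𝒟 heven
      have key : weilJ 𝒟 sgn ^ 2 * (weilT 𝒟 1 * (weilJ 𝒟 sgn * (weilT 𝒟 1 * (weilJ 𝒟 sgn *
          weilT 𝒟 1)))) = weilJ 𝒟 sgn := by
        refine LinearMap.ext fun f => funext fun β => ?_
        change weilJ 𝒟 sgn (weilJ 𝒟 sgn (weilT 𝒟 1 (weilJ 𝒟 sgn (weilT 𝒟 1 (weilJ 𝒟 sgn
          (weilT 𝒟 1 f)))))) β = _
        rw [weilJ_sq, weilJ_T_J 𝒟 hs, neg_neg, ← mul_assoc, ← pow_add, exp_sgn_pow_four heven,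
          one_mul]
      ext1
      change (weilJ 𝒟 sgn * weilT 𝒟 1) ^ 3 = 1
      calc (weilJ 𝒟 sgn * weilT 𝒟 1) ^ 3
          = weilJ 𝒟 sgn ^ 4 * (weilJ 𝒟 sgn * weilT 𝒟 1) ^ 3 := by rw [h4, one_mul]
        _ = weilJ 𝒟 sgn ^ 3 * (weilJ 𝒟 sgn ^ 2 * (weilT 𝒟 1 * (weilJ 𝒟 sgn * (weilT 𝒟 1 *
            (weilJ 𝒟 sgn * weilT 𝒟 1))))) := by simp only [pow_succ, pow_zero, one_mul, mul_assoc]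
        _ = 1 := by rw [key, ← pow_succ, h4])
    (by
      change (weilJUnit 𝒟 heven) ^ 2 * weilTUnit 𝒟 = weilTUnit 𝒟 * (weilJUnit 𝒟 heven) ^ 2
      ext1
      refine LinearMap.ext fun f => funext fun β => ?_
      change weilJ 𝒟 sgn (weilJ 𝒟 sgn (weilT 𝒟 1 f)) β = weilT 𝒟 1 (fun b => weilJ 𝒟 sgn
        (weilJ 𝒟 sgn f) b) β
      simp only [weilJ_sq, weilT, LinearMap.coe_mk, AddHom.coe_mk, q_neg]
      ring)

/-- The matrix `J = (0, 1; -1, 0)`. -/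
def matJ : SL(2, ℤ) := S⁻¹

theorem coe_matJ : (matJ : Matrix (Fin 2) (Fin 2) ℤ) = !![0, 1; -1, 0] := by decide

theorem weilRep_T {sgn : ℤ} (hs : 𝒟.HasSignature sgn) (heven : Even sgn) (γ : D) :
    weilRep 𝒟 hs heven T (Pi.single γ 1) = e (𝒟.q γ) • Pi.single γ 1 := by
  have h0 : ∀ (j t : (Module.End ℂ (D → ℂ))ˣ), word j t T = t := by
    intro j t
    rw [word_zero j t (by decide)]
    have h1 : T 0 0 = 1 := by decide
    have h2 : T 0 1 = 1 := by decide
    rw [if_pos h1, h1, h2]; simp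
  have : weilRep 𝒟 hs heven T = weilT 𝒟 1 := congrArg Units.val (h0 _ _)
  rw [this]
  ext β
  simp only [weilT, LinearMap.coe_mk, AddHom.coe_mk, one_smul, Pi.smul_apply, smul_eq_mul]
  by_cases h : β = γ
  · rw [h]
  · rw [Pi.single_eq_of_ne h, mul_zero, mul_zero]

theorem weilRep_J {sgn : ℤ} (hs : 𝒟.HasSignature sgn) (heven : Even sgn) (γ : D) :
    weilRep 𝒟 hs heven matJ (Pi.single γ 1) =
      (Complex.exp (2 * Real.pi * Complex.I * (sgn / 8)) / (Real.sqrt (Fintype.card D) : ℂ)) •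
        ∑ β : D, e (𝒟.bil γ β) • Pi.single β 1 := by
  have h0 : ∀ (j t : (Module.End ℂ (D → ℂ))ˣ), word j t matJ = j := by
    intro j t
    have h1 : matJ 0 0 = 0 := by decide
    have h2 : matJ 1 0 = -1 := by decide
    have h3 : euclidStep matJ = 1 := by
      rw [euclidStep, h1, Int.zero_fdiv]; simp [matJ]
    rw [word_ne j t (by rw [h2]; decide), h3, h1, word_zero j t (by simp)]
    simp
  have : weilRep 𝒟 hs heven matJ = weilJ 𝒟 sgn := congrArg Units.val (h0 _ _)
  rw [this]
  ext β
  simp [weilJ, Pi.single_apply, Finset.sum_apply]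

end WeilRepresentation

section ModularForms

open UpperHalfPlane Manifold

variable {D : Type*}

/-- The Petersson slash operator
`(f|_k[M])(z) = det(M)^{k/2} (c z + d)^{-k} f((a z + b) / (c z + d))` for an integral matrix `M` of
positive determinant (then `(a z + b) / (c z + d)` lies in `ℍ`, where `ofComplex` is the
identity). -/
def slash (k : ℤ) (M : Matrix (Fin 2) (Fin 2) ℤ) (f : ℍ → D → ℂ) (z : ℍ) : D → ℂ :=
  ((((M.det : ℝ) ^ ((k : ℝ) / 2) : ℝ) : ℂ) * ((M 1 0 : ℂ) * z + (M 1 1 : ℂ)) ^ (-k)) •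
    f (ofComplex (((M 0 0 : ℂ) * z + (M 0 1 : ℂ)) / ((M 1 0 : ℂ) * z + (M 1 1 : ℂ))))

/-- Vector valued modular forms of weight `k` for a representation `ρ` of `SL(2, ℤ)` on `ℂ[D]`. -/
structure IsModularForm (ρ : SL(2, ℤ) →* Module.End ℂ (D → ℂ)) (k : ℤ) (f : ℍ → D → ℂ) :
    Prop where
  slash_eq : ∀ (M : SL(2, ℤ)) (z : ℍ), slash k (M : Matrix (Fin 2) (Fin 2) ℤ) f z = ρ M (f z)
  holomorphic : ∀ γ : D, MDifferentiable 𝓘(ℂ) 𝓘(ℂ) fun z : ℍ => f z γ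
  bounded : ∀ y : ℝ, 0 < y → ∃ C : ℝ, ∀ z : ℍ, y ≤ z.im → ∀ γ : D, ‖f z γ‖ ≤ C

/-- Cusp forms: the constant Fourier coefficients vanish, that is, every component tends to `0` as
`Im z → ∞`. -/
structure IsCuspForm (ρ : SL(2, ℤ) →* Module.End ℂ (D → ℂ)) (k : ℤ) (f : ℍ → D → ℂ) : Prop extends
    IsModularForm ρ k f where
  zero_at_infty : ∀ γ : D, IsZeroAtImInfty fun z : ℍ => f z γ

end ModularForms

section HeckeOperators

open UpperHalfPlane

variable {D : Type*} [AddCommGroup D] [Fintype D] [DecidableEq D]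

/-- The matrix `α = (l², 0; 0, 1)`. -/
def heckeAlpha (l : ℕ) : Matrix (Fin 2) (Fin 2) ℤ := !![(l : ℤ) ^ 2, 0; 0, 1]

/-- The double coset `M_l = Γ α Γ`. -/
def heckeSet (l : ℕ) : Set (Matrix (Fin 2) (Fin 2) ℤ) :=
  {δ | ∃ A B : SL(2, ℤ), δ =
    (A : Matrix (Fin 2) (Fin 2) ℤ) * heckeAlpha l * (B : Matrix (Fin 2) (Fin 2) ℤ)}

/-- The equivalence relation on `M_l` whose classes are the cosets `Γ δ`. -/
def heckeSetoid (l : ℕ) : Setoid (heckeSet l) where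
  r δ δ' := ∃ A : SL(2, ℤ), (δ' : Matrix (Fin 2) (Fin 2) ℤ) = (A : Matrix (Fin 2) (Fin 2) ℤ) * δ
  iseqv :=
    { refl := fun δ => ⟨1, by simp⟩
      symm := by
        rintro δ δ' ⟨A, h⟩
        refine ⟨A⁻¹, ?_⟩
        rw [h, ← mul_assoc, ← Matrix.SpecialLinearGroup.coe_mul, inv_mul_cancel]
        simp
      trans := by
        rintro δ δ' δ'' ⟨A, h⟩ ⟨B, h'⟩
        refine ⟨B * A, ?_⟩
        rw [h', h, Matrix.SpecialLinearGroup.coe_mul, mul_assoc] }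

/-- The operator `ρ(α)⁻¹ : e^γ ↦ e^{l γ}` on `ℂ[D]`. -/
def alphaInv (D : Type*) [AddCommGroup D] [Fintype D] [DecidableEq D] (l : ℕ) :
    Module.End ℂ (D → ℂ) :=
  Fintype.linearCombination ℂ fun γ : D => Pi.single (M := fun _ => ℂ) (l • γ) 1

/-- The operator `ρ(δ)⁻¹ = ρ(B⁻¹) ρ(α)⁻¹ ρ(A⁻¹)` for `δ = A α B ∈ M_l`; for the Weil representation
it does not depend on the choice of the factorization. -/
def heckeInv (ρ : SL(2, ℤ) →* Module.End ℂ (D → ℂ)) (l : ℕ) (δ : heckeSet l) :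
    Module.End ℂ (D → ℂ) :=
  ρ (δ.2.choose_spec.choose)⁻¹ * alphaInv D l * ρ (δ.2.choose)⁻¹

/-- The Hecke operator `T(l²) f = l^{k-2} ∑_i ρ(δ_i)⁻¹ f|_k[δ_i]`, where `δ_i` runs through
representatives of the (finitely many) cosets `Γ δ_i` in `M_l`. -/
def heckeT (ρ : SL(2, ℤ) →* Module.End ℂ (D → ℂ)) (k : ℤ) (l : ℕ) (f : ℍ → D → ℂ) (z : ℍ) : D → ℂ :=
  (l : ℂ) ^ (k - 2) • ∑ᶠ c : Quotient (heckeSetoid l), heckeInv ρ l c.out (slash k c.out f z)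

/-- `(∑_{r ≥ 0} T(p^{2r}) / p^{rs}) f` converges, with limit `g`. -/
def HasHeckeSeries (ρ : SL(2, ℤ) →* Module.End ℂ (D → ℂ)) (k : ℤ) (s : ℂ) (p : ℕ)
    (f g : ℍ → D → ℂ) : Prop :=
  ∀ (z : ℍ), Filter.Tendsto
    (fun n : ℕ => ∑ r ∈ Finset.range n, ((p : ℂ) ^ ((r : ℂ) * s))⁻¹ • heckeT ρ k (p ^ r) f z)
    Filter.atTop (nhds (g z))

/-- `∏_{p} (∑_{r ≥ 0} T(p^{2r}) / p^{rs}) f` converges, with limit `g`, where the product of operators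
runs over the entries of a list and the last entry acts first. -/
inductive HasHeckeProduct (ρ : SL(2, ℤ) →* Module.End ℂ (D → ℂ)) (k : ℤ) (s : ℂ) :
    List ℕ → (ℍ → D → ℂ) → (ℍ → D → ℂ) → Prop
  | nil (f : ℍ → D → ℂ) : HasHeckeProduct ρ k s [] f f
  | cons {p : ℕ} {ps : List ℕ} {f g h : ℍ → D → ℂ} :
      HasHeckeProduct ρ k s ps f g → HasHeckeSeries ρ k s p g h → HasHeckeProduct ρ k s (p :: ps) f h

end HeckeOperators

section Symmetry

variable {D : Type*} [AddCommGroup D] [Fintype D] [DecidableEq D]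

/-- The `p`-adic component of `γ`: with `|D| = p^a b` and `p ∤ b`, the integer `b ^ φ(p^a)` is `1`
modulo `p^a` and `0` modulo `b`, so that multiplication by it is the projection of `D` to its
`p`-primary part. -/
def padicComponent (p : ℕ) (γ : D) : D :=
  (ordCompl[p] (Fintype.card D) ^ Nat.totient (ordProj[p] (Fintype.card D))) • γ

/-- The element `γ_S^μ` whose `p`-adic component is that of `μ` for `p ∈ S` and that of `γ` for all
other primes `p`. -/
def mixed (γ μ : D) (S : Finset ℕ) : D :=
  ∑ p ∈ (Fintype.card D).primeFactors, padicComponent p (if p ∈ S then μ else γ)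

/-- `v_{γ,μ,P} = ∑_{S ⊆ P} (-1)^{|S|} e^{γ_S^μ}`. -/
def symVec (γ μ : D) (P : Finset ℕ) : D → ℂ :=
  ∑ S ∈ P.powerset, (-1 : ℂ) ^ S.card • Pi.single (mixed γ μ S) 1

/-- The scalar product on `ℂ[D]`, linear in the first and antilinear in the second argument, for
which the `e^γ` are orthonormal. -/
def pairing (v w : D → ℂ) : ℂ := ∑ γ : D, v γ * star (w γ)

end Symmetry

end

end VVHecke

open scoped MatrixGroups

/-! The idea is to find a space of vectors that contains `v_{γ,μ,P}`, is stable under the Weil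
representation, and is orthogonal to everything that the operators `T(p^{2r})` with `r ≥ 1` produce.
For a prime `p` the conditions of `IsAdmissible` define such a space. Stability under `T` is clear.
For `J`, the defining conditions of the transformed vector become sums of `w` against quadratic
Gauss sums over cosets of the `p`-torsion. These sums either vanish or transform under `p`-torsion
shifts in such a way that the coset sums of `w` appear (`IsAdmissible.weilJ`). Both generators are
symmetric for the bilinear pairing, so the annihilator of the vectors admissible at all `p ∈ P` is
stable as well. The image of `ρ(α)⁻¹` for `l = p^r`, `r ≥ 1`, is supported on `D^p`, where
admissible vectors vanish. Hence `T(p^{2r})` maps every function into the annihilator, while `T(1)`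
fixes `f`. Modulo the annihilator, which is closed, each series therefore acts on `f` as the
identity. Finally `v_{γ,μ,P}` is admissible at every `p ∈ P`: its support avoids `D^p` and `D^{2*}`,
and the terms of `S` and `S ∪ {p}` lie in the same `p`-torsion coset with equal `q` and opposite
signs (`isAdmissible_symVec`). -/

namespace VVHecke

open ModularGroup DiscriminantForm

variable {D : Type*} [AddCommGroup D]

/-! ### Values of the quadratic and bilinear forms on torsion elements. -/

section Bilinear

variable (𝒟 : DiscriminantForm D)

theorem bil_nsmul_left (n : ℕ) (x y : D) : 𝒟.bil (n • x) y = n • 𝒟.bil x y := by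
  induction n with
  | zero => rw [zero_nsmul, zero_nsmul]; exact QuadraticMap.polar_zero_left 𝒟.q y
  | succ n ih => rw [succ_nsmul, bil_add_left, ih, succ_nsmul]

theorem bil_nsmul_right (n : ℕ) (x y : D) : 𝒟.bil x (n • y) = n • 𝒟.bil x y := by
  rw [bil_comm, bil_nsmul_left, bil_comm]

theorem bil_zsmul_right (n : ℤ) (x y : D) : 𝒟.bil x (n • y) = n • 𝒟.bil x y := by
  simp [bil, QuadraticMap.polar_smul_right]

theorem q_zsmul (n : ℤ) (x : D) : 𝒟.q (n • x) = (n * n) • 𝒟.q x := QuadraticMap.map_smul _ _ _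

theorem q_nsmul (n : ℕ) (x : D) : 𝒟.q (n • x) = (n * n) • 𝒟.q x := by
  have := q_zsmul 𝒟 n x
  rw [natCast_zsmul] at this
  rw [this, ← Nat.cast_mul, natCast_zsmul]

theorem nsmul_bil_of_torsion {p : ℕ} {a : D} (ha : p • a = 0) (y : D) : p • 𝒟.bil y a = 0 := by
  rw [← bil_nsmul_right, ha]; exact QuadraticMap.polar_zero_right _ _

theorem nsmul_q_of_torsion {p : ℕ} {a : D} (ha : p • a = 0) : (p * p) • 𝒟.q a = 0 := by
  rw [← q_nsmul, ha]; exact QuadraticMap.map_zero _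

/-- For odd `p` the quadratic form takes values killed by `p` on the `p`-torsion. -/
theorem nsmul_q_of_torsion_of_odd {p : ℕ} (hp : Odd p) {a : D} (ha : p • a = 0) :
    p • 𝒟.q a = 0 := by
  have h1 : (2 : ℕ) • 𝒟.q a = 𝒟.bil a a := by
    have h := q_nsmul 𝒟 2 a
    rw [two_nsmul, q_add] at h
    have h2 : (2 * 2) • 𝒟.q a = 2 • 𝒟.q a + 2 • 𝒟.q a := by rw [← add_nsmul]
    rw [h2, two_nsmul] at h
    rw [two_nsmul]
    exact (add_left_cancel h).symm
  have h2 : (p * 2) • 𝒟.q a = 0 := by rw [mul_nsmul', h1, nsmul_bil_of_torsion 𝒟 ha]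
  have h3 := nsmul_q_of_torsion 𝒟 ha
  obtain ⟨t, rfl⟩ := hp
  -- For `p = 2t + 1` one has `p = p² - t · 2p`, and both `p²` and `2p` kill `q(a)`.
  have : (2 * t + 1) • 𝒟.q a =
      ((2 * t + 1) * (2 * t + 1)) • 𝒟.q a - t • ((2 * t + 1) * 2) • 𝒟.q a := by
    module
  rw [this, h2, h3]; simp

end Bilinear

/-! ### Admissible vectors and their stability under `T` and `J`. -/

section AdmissibleVectors

variable [Fintype D] [DecidableEq D] (𝒟 : DiscriminantForm D)

/-- The `p`-torsion of `D`. -/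
def torsion (D : Type*) [AddCommGroup D] [Fintype D] [DecidableEq D] (p : ℕ) : Finset D :=
  {a : D | p • a = 0}

theorem mem_torsion {p : ℕ} {a : D} : a ∈ torsion D p ↔ p • a = 0 := by simp [torsion]

theorem sum_torsion_add {p : ℕ} {a : D} (ha : p • a = 0) (F : D → ℂ) :
    ∑ ε ∈ torsion D p, F (ε + a) = ∑ ε ∈ torsion D p, F ε := by
  refine Finset.sum_equiv (Equiv.addRight a) (fun ε => ?_) fun ε _ => rfl
  simp [mem_torsion, ha]

/-- The vectors that vanish on `D^p` (and on `D^{2*}` if `p = 2`) and whose twisted sums over the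
cosets of the `p`-torsion vanish. They form a subrepresentation of the Weil representation. -/
structure IsAdmissible (p : ℕ) (w : D → ℂ) : Prop where
  mulImage : ∀ x ∈ mulImage D p, w x = 0
  starCoset : p = 2 → ∀ x ∈ 𝒟.starCoset 2, w x = 0
  sum_coset : ∀ (n : ℤ) (δ : D), ∑ ε ∈ torsion D p, e (n • 𝒟.q (δ + ε)) * w (δ + ε) = 0

variable {𝒟} {p : ℕ} {w : D → ℂ}

/-- Averaging the sum over translations by the `p`-torsion turns the inner sum, for fixed `γ`, into
a multiple of the coset sum of `w` with twist `m`. -/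
theorem IsAdmissible.sum_mul_eq_zero (hw : IsAdmissible 𝒟 p w) (m : ℤ) (h : D → ℂ)
    (hh : ∀ γ a, p • a = 0 → h (γ + a) = h γ * e (m • (𝒟.q (γ + a) - 𝒟.q γ))) :
    ∑ γ, w γ * h γ = 0 := by
  have key : ∑ a ∈ torsion D p, ∑ γ, w (γ + a) * h (γ + a) = 0 := by
    rw [Finset.sum_comm]
    refine Finset.sum_eq_zero fun γ _ => ?_
    have : ∀ a ∈ torsion D p, w (γ + a) * h (γ + a) =
        h γ * e (-(m • 𝒟.q γ)) * (e (m • 𝒟.q (γ + a)) * w (γ + a)) := by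
      intro a ha
      rw [hh γ a (mem_torsion.1 ha), smul_sub, sub_eq_add_neg, e_add]; ring
    rw [Finset.sum_congr rfl this, ← Finset.mul_sum, hw.sum_coset, mul_zero]
  have : ∀ a ∈ torsion D p, ∑ γ, w (γ + a) * h (γ + a) = ∑ γ, w γ * h γ := fun a _ =>
    Equiv.sum_comp (Equiv.addRight a) fun γ => w γ * h γ
  rw [Finset.sum_congr rfl this, Finset.sum_const, nsmul_eq_mul] at key
  refine (mul_eq_zero.1 key).resolve_left (Nat.cast_ne_zero.2 (Finset.card_ne_zero_of_mem
    (a := (0 : D)) (mem_torsion.2 (smul_zero _))))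

/-- The `p`-torsion is orthogonal exactly to `D^p`. -/
theorem sum_torsion_e_bil {γ : D} (hγ : γ ∉ mulImage D p) :
    ∑ ε ∈ torsion D p, e (𝒟.bil γ ε) = 0 := by
  -- The condition `p ε = 0` is detected by the character sum over `y`. Summing over `ε` first
  -- leaves only those `y` with `p y + γ = 0`, and there are none.
  have h1 : ∀ ε : D, ∑ y : D, e (𝒟.bil y (p • ε)) * e (𝒟.bil γ ε) =
      if p • ε = 0 then (Fintype.card D : ℂ) * e (𝒟.bil γ ε) else 0 := by
    intro ε
    rw [← Finset.sum_mul, sum_e_bil]; split_ifs <;> simp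
  have h2 : ∑ ε : D, ∑ y : D, e (𝒟.bil y (p • ε)) * e (𝒟.bil γ ε) = 0 := by
    rw [Finset.sum_comm]
    refine Finset.sum_eq_zero fun y _ => ?_
    have : ∀ ε : D, e (𝒟.bil y (p • ε)) * e (𝒟.bil γ ε) = e (𝒟.bil ε (p • y + γ)) := by
      intro ε
      rw [← e_add, bil_add_right, bil_nsmul_right, bil_nsmul_right, bil_comm 𝒟 y ε,
        bil_comm 𝒟 γ ε]
    simp only [this]
    rw [sum_e_bil, if_neg]
    exact fun h => hγ ⟨-y, by rw [smul_neg, neg_eq_iff_add_eq_zero, h]⟩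
  simp only [h1, ← Finset.sum_filter] at h2
  rw [← Finset.mul_sum] at h2
  exact (mul_eq_zero.1 h2).resolve_left (Nat.cast_ne_zero.2 Fintype.card_ne_zero)

/-- Multiplication by `e(m q)` shifts the twist from `n` to `n + m`; this is why the coset condition
is imposed for all `n`. -/
theorem IsAdmissible.weilT (hw : IsAdmissible 𝒟 p w) (m : ℤ) :
    IsAdmissible 𝒟 p (weilT 𝒟 m w) where
  mulImage x hx := by
    change e (m • 𝒟.q x) * w x = 0
    rw [hw.mulImage x hx, mul_zero]
  starCoset h x hx := by
    change e (m • 𝒟.q x) * w x = 0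
    rw [hw.starCoset h x hx, mul_zero]
  sum_coset n δ := by
    rw [← hw.sum_coset (n + m) δ]
    refine Finset.sum_congr rfl fun ε _ => ?_
    change e (n • 𝒟.q (δ + ε)) * (e (m • 𝒟.q (δ + ε)) * w (δ + ε)) = _
    rw [add_smul, e_add, mul_assoc]

/-- Shifting the argument of a quadratic Gauss sum over a coset of the `p`-torsion. -/
theorem gaussSum_shift {n m : ℤ} (hnm : ((p * p : ℕ) : ℤ) ∣ n * m - 1) (δ γ : D) {a : D}
    (ha : p • a = 0) :
    ∑ ε ∈ torsion D p, e (n • 𝒟.q (δ + ε) + 𝒟.bil (γ + a) (δ + ε)) =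
      (∑ ε ∈ torsion D p, e (n • 𝒟.q (δ + ε) + 𝒟.bil γ (δ + ε))) *
        e ((-m) • (𝒟.q (γ + a) - 𝒟.q γ)) := by
  -- Completing the square: substituting `ε + m a` for `ε` absorbs the linear term in `a`. The
  -- inverse `m` of `n` is taken modulo `p²` because `q` on the `p`-torsion is only known to be
  -- killed by `p²`.
  have hma : p • (m • a) = 0 := by rw [smul_comm, ha, smul_zero]
  rw [← sum_torsion_add hma fun ε => e (n • 𝒟.q (δ + ε) + 𝒟.bil γ (δ + ε)), Finset.sum_mul]
  refine Finset.sum_congr rfl fun ε _ => ?_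
  rw [← e_add, ← add_assoc]
  congr 1
  obtain ⟨t, ht⟩ := hnm
  have hq : (n * m - 1) • 𝒟.q a = 0 := by
    rw [ht, mul_comm, mul_smul, natCast_zsmul, nsmul_q_of_torsion 𝒟 ha, smul_zero]
  have hb : (n * m - 1) • 𝒟.bil (δ + ε) a = 0 := by
    rw [ht, mul_comm, mul_smul, natCast_zsmul, mul_nsmul', nsmul_bil_of_torsion 𝒟 ha, smul_zero,
      smul_zero]
  rw [q_add 𝒟 (δ + ε) (m • a), q_add 𝒟 γ a, q_zsmul, bil_add_right 𝒟 γ (δ + ε), bil_add_left,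
    bil_zsmul_right, bil_zsmul_right, bil_comm 𝒟 a (δ + ε)]
  linear_combination (norm := module) (-m) • hq - hb

/-- When `p` divides the twist, the quadratic term is additive on the `p`-torsion, so the Gauss sum
is a character sum up to a factor. The character can be trivial only for `γ` in `D^p`, or in
`D^{2*}` when `p = 2`, where `w` vanishes. -/
theorem IsAdmissible.mul_gaussSum_eq_zero (hw : IsAdmissible 𝒟 p w) (hp : p.Prime) (j : ℤ)
    (δ γ : D) :
    w γ * ∑ ε ∈ torsion D p, e ((p * j) • 𝒟.q (δ + ε) + 𝒟.bil γ (δ + ε)) = 0 := by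
  by_cases hγ : γ ∈ VVHecke.DiscriminantForm.mulImage D p
  · rw [hw.mulImage γ hγ, zero_mul]
  have h1 : ∀ ε ∈ torsion D p, e ((p * j) • 𝒟.q (δ + ε) + 𝒟.bil γ (δ + ε)) =
      e ((p * j) • 𝒟.q δ + 𝒟.bil γ δ) * e ((p * j) • 𝒟.q ε + 𝒟.bil γ ε) := by
    intro ε hε
    rw [← e_add, q_add, bil_add_right]
    congr 1
    have : ((p : ℤ) * j) • 𝒟.bil δ ε = 0 := by
      rw [mul_comm, mul_smul, natCast_zsmul, nsmul_bil_of_torsion 𝒟 (mem_torsion.1 hε), smul_zero]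
    linear_combination (norm := module) this
  rw [Finset.sum_congr rfl h1, ← Finset.mul_sum]
  -- The quadratic term can survive only for `p = 2` and odd `j`; since `4 q(ε) = 0`, it then equals
  -- `2 q(ε)`, the expression that defines `D^{2*}`.
  by_cases hz : ∀ ε ∈ torsion D p, ((p : ℤ) * j) • 𝒟.q ε = 0
  · have h2 : ∀ ε ∈ torsion D p, e ((p * j) • 𝒟.q ε + 𝒟.bil γ ε) = e (𝒟.bil γ ε) := by
      intro ε hε
      rw [hz ε hε, zero_add]
    rw [Finset.sum_congr rfl h2, sum_torsion_e_bil hγ, mul_zero, mul_zero]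
  rcases hp.eq_two_or_odd' with rfl | hodd
  swap
  · exact absurd (fun ε hε => by rw [mul_comm, mul_smul, natCast_zsmul,
      nsmul_q_of_torsion_of_odd 𝒟 hodd (mem_torsion.1 hε), smul_zero]) hz
  have h4 : ∀ ε ∈ torsion D 2, (2 * 2 : ℕ) • 𝒟.q ε = 0 := fun ε hε =>
    nsmul_q_of_torsion 𝒟 (mem_torsion.1 hε)
  rcases Int.even_or_odd' j with ⟨i, rfl | rfl⟩
  · refine absurd (fun ε hε => ?_) hz
    have : (((2 : ℕ) : ℤ) * (2 * i)) • 𝒟.q ε = i • (2 * 2 : ℕ) • 𝒟.q ε := by module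
    rw [this, h4 ε hε, smul_zero]
  have h5 : ∀ ε ∈ torsion D 2, (((2 : ℕ) : ℤ) * (2 * i + 1)) • 𝒟.q ε = (2 : ℕ) • 𝒟.q ε := by
    intro ε hε
    have : (((2 : ℕ) : ℤ) * (2 * i + 1)) • 𝒟.q ε = i • (2 * 2 : ℕ) • 𝒟.q ε + (2 : ℕ) • 𝒟.q ε := by
      module
    rw [this, h4 ε hε, smul_zero, zero_add]
  by_cases hs : γ ∈ 𝒟.starCoset 2
  · rw [hw.starCoset rfl γ hs, zero_mul]
  obtain ⟨a, ha, hne⟩ : ∃ a : D, 2 • a = 0 ∧ 2 • 𝒟.q a + 𝒟.bil a γ ≠ 0 := by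
    simpa [DiscriminantForm.starCoset] using hs
  set F : D → ℂ := fun ε => e ((((2 : ℕ) : ℤ) * (2 * i + 1)) • 𝒟.q ε + 𝒟.bil γ ε)
  have h6 : ∀ ε ∈ torsion D 2, F (ε + a) = F ε * e (2 • 𝒟.q a + 𝒟.bil a γ) := by
    intro ε hε
    have hεa : ε + a ∈ torsion D 2 := by
      rw [mem_torsion, smul_add, ha, mem_torsion.1 hε, add_zero]
    simp only [F]
    rw [h5 _ hεa, h5 _ hε, ← e_add, q_add, bil_add_right, bil_comm 𝒟 a γ]
    congr 1
    have := nsmul_bil_of_torsion 𝒟 ha ε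
    linear_combination (norm := module) this
  have h7 := sum_torsion_add ha F
  rw [Finset.sum_congr rfl h6, ← Finset.sum_mul] at h7
  have h8 : e (2 • 𝒟.q a + 𝒟.bil a γ) ≠ 1 := fun h => hne (e_eq_one h)
  have h9 : ∑ ε ∈ torsion D 2, F ε = 0 := by
    by_contra h
    exact h8 (mul_left_cancel₀ h (by rw [h7, mul_one]))
  rw [h9, mul_zero, mul_zero]

omit [DecidableEq D] in
theorem weilJ_apply (sgn : ℤ) (β : D) : weilJ 𝒟 sgn w β =
    Complex.exp (2 * Real.pi * Complex.I * (sgn / 8)) / (Real.sqrt (Fintype.card D) : ℂ) *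
      ∑ γ : D, w γ * e (𝒟.bil γ β) := rfl

/-- Each condition on the transform is a sum of `w` against a kernel that changes under `p`-torsion
shifts by a twist: `0` for `D^p`, `-2` for `D^{2*}`, and `-n⁻¹` modulo `p²` for coset sums with `p ∤
n`. For `p ∣ n` every term already vanishes. -/
theorem IsAdmissible.weilJ (hw : IsAdmissible 𝒟 p w) (hp : p.Prime) (sgn : ℤ) :
    IsAdmissible 𝒟 p (weilJ 𝒟 sgn w) where
  mulImage := by
    rintro _ ⟨x, rfl⟩
    rw [weilJ_apply, hw.sum_mul_eq_zero 0, mul_zero]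
    intro γ a ha
    rw [zero_smul, e_zero, mul_one, bil_nsmul_right, bil_nsmul_right, bil_add_left, smul_add,
      bil_comm 𝒟 a, nsmul_bil_of_torsion 𝒟 ha, add_zero]
  starCoset := by
    rintro rfl x hx
    rw [weilJ_apply, hw.sum_mul_eq_zero (-2), mul_zero]
    intro γ a ha
    rw [← e_add, bil_add_left, q_add]
    congr 1
    have h1 := hx a ha
    have h2 := nsmul_bil_of_torsion 𝒟 ha γ
    linear_combination (norm := module) h1 + h2
  sum_coset n δ := by
    set c := Complex.exp (2 * Real.pi * Complex.I * (sgn / 8)) / (Real.sqrt (Fintype.card D) : ℂ)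
    have h1 : ∑ ε ∈ torsion D p, e (n • 𝒟.q (δ + ε)) * VVHecke.weilJ 𝒟 sgn w (δ + ε) =
        c * ∑ γ, w γ * ∑ ε ∈ torsion D p, e (n • 𝒟.q (δ + ε) + 𝒟.bil γ (δ + ε)) := by
      simp only [weilJ_apply, Finset.mul_sum]
      rw [Finset.sum_comm]
      refine Finset.sum_congr rfl fun γ _ => Finset.sum_congr rfl fun ε _ => ?_
      rw [e_add]; ring
    rw [h1]
    by_cases hn : (p : ℤ) ∣ n
    · obtain ⟨j, rfl⟩ := hn
      rw [Finset.sum_eq_zero fun γ _ => hw.mul_gaussSum_eq_zero hp j δ γ, mul_zero]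
    · have hc : IsCoprime n ((p * p : ℕ) : ℤ) := by
        have : IsCoprime (p : ℤ) n :=
          (Prime.coprime_iff_not_dvd (Nat.prime_iff_prime_int.1 hp)).2 hn
        push_cast
        exact (this.symm).mul_right this.symm
      obtain ⟨m, t, hm⟩ := hc
      rw [hw.sum_mul_eq_zero (-m), mul_zero]
      intro γ a ha
      exact gaussSum_shift ⟨-t, by linear_combination hm⟩ δ γ ha

end AdmissibleVectors

/-! ### The annihilator as a subrepresentation containing the images of `ρ(α)⁻¹`. -/

section Annihilator

variable [Fintype D] [DecidableEq D] (𝒟 : DiscriminantForm D)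

/-- The vectors orthogonal to all vectors that are admissible for every `p ∈ P`. -/
def annihilator (P : Finset ℕ) : Submodule ℂ (D → ℂ) where
  carrier := {x | ∀ w : D → ℂ, (∀ p ∈ P, IsAdmissible 𝒟 p w) → ∑ γ, x γ * w γ = 0}
  add_mem' hx hy w hw := by
    simp [add_mul, Finset.sum_add_distrib, hx w hw, hy w hw]
  zero_mem' w _ := by simp
  smul_mem' c x hx w hw := by
    simp [mul_assoc, ← Finset.mul_sum, hx w hw]

variable {𝒟} {P : Finset ℕ} {x : D → ℂ} {sgn : ℤ}

theorem mem_annihilator : x ∈ annihilator 𝒟 P ↔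
    ∀ w : D → ℂ, (∀ p ∈ P, IsAdmissible 𝒟 p w) → ∑ γ, x γ * w γ = 0 := Iff.rfl

theorem weilT_mem_annihilator (m : ℤ) (hx : x ∈ annihilator 𝒟 P) :
    weilT 𝒟 m x ∈ annihilator 𝒟 P := by
  rw [mem_annihilator] at hx ⊢
  intro w hw
  rw [← hx _ fun p hp => (hw p hp).weilT m]
  refine Finset.sum_congr rfl fun γ _ => ?_
  change e (m • 𝒟.q γ) * x γ * w γ = x γ * (e (m • 𝒟.q γ) * w γ)
  ring

/-- The kernel `e((γ, β))` is symmetric, so `J` is its own transpose for the bilinear pairing and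
moves over to the admissible vector. -/
theorem weilJ_mem_annihilator (hP : ∀ p ∈ P, p.Prime) (hx : x ∈ annihilator 𝒟 P) :
    weilJ 𝒟 sgn x ∈ annihilator 𝒟 P := by
  rw [mem_annihilator] at hx ⊢
  intro w hw
  rw [← hx _ fun p hp => (hw p hp).weilJ (hP p hp) sgn]
  simp only [weilJ_apply, Finset.mul_sum, Finset.sum_mul]
  rw [Finset.sum_comm]
  refine Finset.sum_congr rfl fun γ _ => Finset.sum_congr rfl fun β _ => ?_
  rw [bil_comm]; ring

theorem weilRep_T_eq (hs : 𝒟.HasSignature sgn) (heven : Even sgn) :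
    weilRep 𝒟 hs heven T = weilT 𝒟 1 := by
  refine LinearMap.pi_ext' fun γ => LinearMap.ext_ring ?_
  change weilRep 𝒟 hs heven T (Pi.single γ 1) = weilT 𝒟 1 (Pi.single γ 1)
  rw [weilRep_T]
  ext β
  change _ = e ((1 : ℤ) • 𝒟.q β) * _
  by_cases h : β = γ
  · subst h; simp
  · simp [h]

theorem weilRep_matJ_eq (hs : 𝒟.HasSignature sgn) (heven : Even sgn) :
    weilRep 𝒟 hs heven matJ = weilJ 𝒟 sgn := by
  refine LinearMap.pi_ext' fun γ => LinearMap.ext_ring ?_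
  change weilRep 𝒟 hs heven matJ (Pi.single γ 1) = weilJ 𝒟 sgn (Pi.single γ 1)
  rw [weilRep_J]
  ext β
  simp [weilJ_apply, Pi.single_apply, Finset.sum_apply]

theorem weilRep_mem_annihilator (hs : 𝒟.HasSignature sgn) (heven : Even sgn)
    (hP : ∀ p ∈ P, p.Prime) (M : SL(2, ℤ)) (hx : x ∈ annihilator 𝒟 P) :
    weilRep 𝒟 hs heven M x ∈ annihilator 𝒟 P := by
  have hJ : ∀ x ∈ annihilator 𝒟 P, weilRep 𝒟 hs heven matJ x ∈ annihilator 𝒟 P := by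
    intro x hx
    rw [weilRep_matJ_eq]
    exact weilJ_mem_annihilator hP hx
  have hinv : ∀ N : SL(2, ℤ), weilRep 𝒟 hs heven N⁻¹ * weilRep 𝒟 hs heven N = 1 := by
    intro N
    rw [← map_mul, inv_mul_cancel, map_one]
  -- Stability under `M` and `M⁻¹` is proved together, so that the induction passes through
  -- inverses.
  have key : ∀ M ∈ Subgroup.closure ({S, T} : Set SL(2, ℤ)),
      (∀ x ∈ annihilator 𝒟 P, weilRep 𝒟 hs heven M x ∈ annihilator 𝒟 P) ∧
      ∀ x ∈ annihilator 𝒟 P, weilRep 𝒟 hs heven M⁻¹ x ∈ annihilator 𝒟 P := by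
    intro M hM
    induction hM using Subgroup.closure_induction with
    | mem N hN =>
      rcases hN with rfl | rfl
      · refine ⟨fun x hx => ?_, hJ⟩
        have : S = matJ * (matJ * matJ) := by decide
        rw [this, map_mul, map_mul]
        exact hJ _ (hJ _ (hJ _ hx))
      · refine ⟨fun x hx => by rw [weilRep_T_eq]; exact weilT_mem_annihilator 1 hx, fun x hx => ?_⟩
        have : weilRep 𝒟 hs heven T⁻¹ = weilT 𝒟 (-1) := by
          refine left_inv_eq_right_inv (hinv T) ?_
          rw [weilRep_T_eq, weilT_mul, add_neg_cancel, weilT_zero]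
        rw [this]
        exact weilT_mem_annihilator _ hx
    | one => simp
    | mul A B _ _ hA hB =>
      rw [mul_inv_rev, map_mul, map_mul]
      exact ⟨fun x hx => hA.1 _ (hB.1 _ hx), fun x hx => hB.2 _ (hA.2 _ hx)⟩
    | inv A _ hA => rw [inv_inv]; exact hA.symm
  exact (key M (by rw [SpecialLinearGroup.SL2Z_generators]; trivial)).1 x hx

/-- The image is spanned by `e^{p^r γ}`, and `p^r γ ∈ D^p` because `r ≥ 1`. -/
theorem alphaInv_mem_annihilator {p r : ℕ} (hp : p ∈ P) (hr : r ≠ 0) (x : D → ℂ) :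
    alphaInv D (p ^ r) x ∈ annihilator 𝒟 P := by
  rw [alphaInv, Fintype.linearCombination_apply]
  refine Submodule.sum_mem _ fun γ _ => Submodule.smul_mem _ _ ?_
  rw [mem_annihilator]
  intro w hw
  have : w (p ^ r • γ) = 0 := (hw p hp).mulImage _ ⟨p ^ (r - 1) • γ, by
    rw [← mul_nsmul', ← pow_succ', Nat.sub_add_cancel (Nat.one_le_iff_ne_zero.2 hr)]⟩
  simp [Pi.single_apply, this]

end Annihilator

/-! ### Hecke operators modulo the annihilator. -/

section Hecke

open UpperHalfPlane

variable [Fintype D] [DecidableEq D] {𝒟 : DiscriminantForm D} {P : Finset ℕ} {sgn k : ℤ}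

theorem heckeT_mem_annihilator (hs : 𝒟.HasSignature sgn) (heven : Even sgn)
    (hP : ∀ p ∈ P, p.Prime) {p r : ℕ} (hp : p ∈ P) (hr : r ≠ 0) (f : ℍ → D → ℂ) (z : ℍ) :
    heckeT (weilRep 𝒟 hs heven) k (p ^ r) f z ∈ annihilator 𝒟 P := by
  refine Submodule.smul_mem _ _ (finsum_induction (· ∈ annihilator 𝒟 P) (Submodule.zero_mem _)
    (fun _ _ => Submodule.add_mem _) fun c => ?_)
  exact weilRep_mem_annihilator hs heven hP _ (alphaInv_mem_annihilator hp hr _)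

theorem exists_heckeInv_one (ρ : SL(2, ℤ) →* Module.End ℂ (D → ℂ)) (δ : heckeSet 1) :
    ∃ M : SL(2, ℤ), (δ : Matrix (Fin 2) (Fin 2) ℤ) = M ∧ heckeInv ρ 1 δ = ρ M⁻¹ := by
  refine ⟨δ.2.choose * δ.2.choose_spec.choose, ?_, ?_⟩
  · have h : heckeAlpha 1 = 1 := by simp [heckeAlpha, Matrix.one_fin_two]
    refine δ.2.choose_spec.choose_spec.trans ?_
    rw [Matrix.SpecialLinearGroup.coe_mul]
    exact congrArg (· * _) ((congrArg (_ * ·) h).trans (mul_one _))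
  · have h : alphaInv D 1 = 1 := by
      refine LinearMap.pi_ext' fun γ => LinearMap.ext_ring ?_
      change alphaInv D 1 (Pi.single γ 1) = Pi.single γ 1
      simp [alphaInv, Fintype.linearCombination_apply_single]
    rw [heckeInv, h, mul_one, mul_inv_rev, map_mul]

/-- `T(1)` is the operator of a single coset, the one of a matrix in `SL(2, ℤ)`. -/
theorem exists_heckeT_one (ρ : SL(2, ℤ) →* Module.End ℂ (D → ℂ)) (k : ℤ) :
    ∃ M : SL(2, ℤ), ∀ (f : ℍ → D → ℂ) (z : ℍ), heckeT ρ k 1 f z = ρ M⁻¹ (slash k M f z) := by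
  have hone : (1 : Matrix (Fin 2) (Fin 2) ℤ) ∈ heckeSet 1 :=
    ⟨1, 1, by simp [heckeAlpha, Matrix.one_fin_two]⟩
  let c₀ : Quotient (heckeSetoid 1) := Quotient.mk _ ⟨1, hone⟩
  have huniq : ∀ c, c = c₀ := by
    intro c
    induction c using Quotient.inductionOn with | _ δ => ?_
    obtain ⟨M, hM, -⟩ := exists_heckeInv_one ρ δ
    exact (Quotient.sound (s := heckeSetoid 1) ⟨M, by simp [hM]⟩).symm
  obtain ⟨M, hM, hinv⟩ := exists_heckeInv_one ρ c₀.out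
  refine ⟨M, fun f z => ?_⟩
  let _ : Unique (Quotient (heckeSetoid 1)) := ⟨⟨c₀⟩, huniq⟩
  rw [heckeT, finsum_unique, Nat.cast_one, one_zpow, one_smul, huniq default, hM, hinv]

/-- Only `f` needs to be modular. The function `g`, a limit of earlier series, enters through its
pointwise congruence to `f`, which the slash operator and `ρ(M⁻¹)` preserve. -/
theorem heckeT_one_sub_mem_annihilator (hs : 𝒟.HasSignature sgn) (heven : Even sgn)
    (hP : ∀ p ∈ P, p.Prime) {f g : ℍ → D → ℂ}
    (hf : ∀ (M : SL(2, ℤ)) (z : ℍ), slash k M f z = weilRep 𝒟 hs heven M (f z))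
    (hg : ∀ z, g z - f z ∈ annihilator 𝒟 P) (z : ℍ) :
    heckeT (weilRep 𝒟 hs heven) k 1 g z - f z ∈ annihilator 𝒟 P := by
  obtain ⟨M, hM⟩ := exists_heckeT_one (weilRep 𝒟 hs heven) k
  have h1 : f z = weilRep 𝒟 hs heven M⁻¹ (slash k M f z) := by
    rw [hf, ← Module.End.mul_apply, ← map_mul, inv_mul_cancel, map_one, Module.End.one_apply]
  rw [hM, h1, ← map_sub, slash, slash, ← smul_sub]
  exact weilRep_mem_annihilator hs heven hP _ (Submodule.smul_mem _ _ (hg _))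

theorem HasHeckeProduct.sub_mem_annihilator (hs : 𝒟.HasSignature sgn) (heven : Even sgn)
    (hP : ∀ p ∈ P, p.Prime) {s : ℂ} {ps : List ℕ} {f g : ℍ → D → ℂ}
    (hf : ∀ (M : SL(2, ℤ)) (z : ℍ), slash k M f z = weilRep 𝒟 hs heven M (f z))
    (h : HasHeckeProduct (weilRep 𝒟 hs heven) k s ps f g) (hps : ∀ p ∈ ps, p ∈ P) (z : ℍ) :
    g z - f z ∈ annihilator 𝒟 P := by
  induction h generalizing z with
  | nil f => simp
  | @cons p ps f g h _ hseries ih =>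
    have hg := ih hf fun p hp => hps p (List.mem_cons_of_mem _ hp)
    have hp : p ∈ P := hps p List.mem_cons_self
    -- Closedness passes the congruence from the partial sums to their limit. Nonempty partial sums
    -- contain the term `r = 0`, which is `T(1) g`; all other terms lie in the annihilator.
    have hclosed : IsClosed (annihilator 𝒟 P : Set (D → ℂ)) := Submodule.closed_of_finiteDimensional _
    refine hclosed.mem_of_tendsto ((hseries z).sub_const (f z)) ?_
    filter_upwards [Filter.eventually_ge_atTop 1] with n hn
    obtain ⟨n, rfl⟩ := Nat.exists_eq_add_of_le' hn
    rw [Finset.sum_range_succ', add_sub_assoc]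
    refine Submodule.add_mem _ (Submodule.sum_mem _ fun r _ => Submodule.smul_mem _ _
      (heckeT_mem_annihilator hs heven hP hp r.succ_ne_zero g z)) ?_
    simpa using heckeT_one_sub_mem_annihilator hs heven hP hf hg z

end Hecke

/-! ### Primary components and the admissibility of `v_{γ,μ,P}`. -/

section SymmetrizedVectors

variable [Fintype D] [DecidableEq D] (𝒟 : DiscriminantForm D)

/-- The integer by which `padicComponent` multiplies. -/
def padicMultiplier (D : Type*) [Fintype D] (p : ℕ) : ℕ :=
  ordCompl[p] (Fintype.card D) ^ Nat.totient (ordProj[p] (Fintype.card D))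

omit [DecidableEq D] in
theorem padicComponent_eq (p : ℕ) (γ : D) : padicComponent p γ = padicMultiplier D p • γ := rfl

omit [AddCommGroup D] [DecidableEq D] in
theorem dvd_padicMultiplier {p p' : ℕ} (hp : p.Prime) (hp' : p'.Prime) (hne : p ≠ p')
    (hdvd : p ∣ Fintype.card D) : p ∣ padicMultiplier D p' := by
  refine dvd_pow ?_ (Nat.totient_pos.2 (Nat.ordProj_pos _ _)).ne'
  have h : p ∣ ordProj[p'] (Fintype.card D) * ordCompl[p'] (Fintype.card D) := by
    rwa [Nat.ordProj_mul_ordCompl_eq_self]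
  exact (hp.dvd_mul.1 h).resolve_left fun h' =>
    hne ((Nat.prime_dvd_prime_iff_eq hp hp').1 (hp.dvd_of_dvd_pow h'))

omit [DecidableEq D] in
theorem coprime_padicMultiplier {p : ℕ} (hp : p.Prime) : p.Coprime (padicMultiplier D p) :=
  (Nat.coprime_ordCompl hp Fintype.card_ne_zero).pow_right _

omit [DecidableEq D] in
theorem ordProj_nsmul_padicComponent (p : ℕ) (γ : D) :
    ordProj[p] (Fintype.card D) • padicComponent p γ = 0 := by
  have h : Fintype.card D ∣ ordProj[p] (Fintype.card D) * padicMultiplier D p := by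
    conv_lhs => rw [← Nat.ordProj_mul_ordCompl_eq_self (Fintype.card D) p]
    exact mul_dvd_mul_left _ (dvd_pow_self _ (Nat.totient_pos.2 (Nat.ordProj_pos _ _)).ne')
  obtain ⟨t, ht⟩ := h
  rw [padicComponent_eq, ← mul_nsmul', ht, mul_nsmul, card_nsmul_eq_zero, smul_zero]

theorem gcd_nsmul_eq_zero {A : Type*} [AddMonoid A] {m n : ℕ} {x : A} (hm : m • x = 0)
    (hn : n • x = 0) : m.gcd n • x = 0 :=
  addOrderOf_dvd_iff_nsmul_eq_zero.1 (Nat.dvd_gcd (addOrderOf_dvd_of_nsmul_eq_zero hm)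
    (addOrderOf_dvd_of_nsmul_eq_zero hn))

omit [DecidableEq D] in
-- The value is killed by powers of two different primes, hence by their gcd `1`.
theorem bil_padicComponent_eq_zero {p p' : ℕ} (hp : p.Prime) (hp' : p'.Prime) (hne : p ≠ p')
    (x y : D) : 𝒟.bil (padicComponent p x) (padicComponent p' y) = 0 := by
  have h1 := nsmul_bil_of_torsion 𝒟 (ordProj_nsmul_padicComponent p' y) (padicComponent p x)
  have h2 := nsmul_bil_of_torsion 𝒟 (ordProj_nsmul_padicComponent p x) (padicComponent p' y)
  rw [bil_comm] at h2
  have h := gcd_nsmul_eq_zero h2 h1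
  rwa [Nat.Coprime.gcd_eq_one (((Nat.coprime_primes hp hp').2 hne).pow _ _), one_nsmul] at h

omit [Fintype D] [DecidableEq D] in
theorem bil_sum_right {ι : Type*} (A : Finset ι) (x : D) (y : ι → D) :
    𝒟.bil x (∑ i ∈ A, y i) = ∑ i ∈ A, 𝒟.bil x (y i) :=
  map_sum (AddMonoidHom.mk' (𝒟.bil x) (bil_add_right 𝒟 x)) y A

omit [DecidableEq D] in
theorem q_sum_padicComponent (A : Finset ℕ) (hA : ∀ p ∈ A, p.Prime) (z : ℕ → D) :
    𝒟.q (∑ p ∈ A, padicComponent p (z p)) =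
      ∑ p ∈ A, (padicMultiplier D p * padicMultiplier D p) • 𝒟.q (z p) := by
  induction A using Finset.induction_on with
  | empty => simp
  | insert p A hp ih =>
    have hpp := hA p (Finset.mem_insert_self _ _)
    have hA' : ∀ p' ∈ A, p'.Prime := fun p' h => hA p' (Finset.mem_insert_of_mem h)
    have h0 : ∑ p' ∈ A, 𝒟.bil (padicComponent p (z p)) (padicComponent p' (z p')) = 0 :=
      Finset.sum_eq_zero fun p' hp' =>
        bil_padicComponent_eq_zero 𝒟 hpp (hA' p' hp') (fun h => hp (h ▸ hp')) _ _
    rw [Finset.sum_insert hp, Finset.sum_insert hp, q_add, ih hA', bil_sum_right, h0, add_zero,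
      padicComponent_eq, q_nsmul]

variable {𝒟} {γ μ : D} {P : Finset ℕ}

omit [DecidableEq D] in
-- The point is that the right side does not depend on `S`: primary components are orthogonal, and
-- those of `γ` and `μ` have equal norms.
theorem q_mixed (hq : 𝒟.q γ = 𝒟.q μ) (S : Finset ℕ) : 𝒟.q (mixed γ μ S) =
    ∑ p ∈ (Fintype.card D).primeFactors, (padicMultiplier D p * padicMultiplier D p) • 𝒟.q γ := by
  rw [mixed, q_sum_padicComponent 𝒟 _ fun p hp => Nat.prime_of_mem_primeFactors hp]
  refine Finset.sum_congr rfl fun p _ => ?_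
  split_ifs <;> simp [hq]

omit [DecidableEq D] in
theorem nsmul_mixed_insert (hP : ∀ p ∈ P, p.Prime) (hdiff : (∏ p ∈ P, p) • (γ - μ) = 0) {p : ℕ}
    (hp : p ∈ P) (S : Finset ℕ) : p • mixed γ μ (insert p S) = p • mixed γ μ S := by
  have key : p • padicComponent p γ = p • padicComponent p μ := by
    have h1 := ordProj_nsmul_padicComponent p (γ - μ)
    have h2 : (p * ∏ p' ∈ P.erase p, p') • padicComponent p (γ - μ) = 0 := by
      rw [Finset.mul_prod_erase P (fun p => p) hp, padicComponent_eq, smul_comm, hdiff, smul_zero]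
    have h3 := gcd_nsmul_eq_zero h1 h2
    have hc : Nat.Coprime (ordProj[p] (Fintype.card D)) (∏ p' ∈ P.erase p, p') := by
      refine Nat.Coprime.pow_left _ (Nat.Coprime.prod_right fun p' hp' => ?_)
      exact (Nat.coprime_primes (hP p hp) (hP p' (Finset.mem_of_mem_erase hp'))).2
        (Finset.ne_of_mem_erase hp').symm
    -- The `p`-component of `γ - μ` is killed by a power of `p` and by the product over `P`; their
    -- gcd divides `p`.
    rw [hc.symm.gcd_mul_right_cancel_right] at h3
    have h4 : p • padicComponent p (γ - μ) = 0 := addOrderOf_dvd_iff_nsmul_eq_zero.1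
      ((addOrderOf_dvd_of_nsmul_eq_zero h3).trans (Nat.gcd_dvd_right _ p))
    rwa [padicComponent_eq, smul_sub, smul_sub, sub_eq_zero] at h4
  simp only [mixed, Finset.smul_sum]
  refine Finset.sum_congr rfl fun p' _ => ?_
  by_cases h : p' = p
  · subst h
    rw [if_pos (Finset.mem_insert_self _ _)]
    split_ifs
    · rfl
    · exact key.symm
  · simp [h]

omit [DecidableEq D] in
-- Modulo `p D` only the `p`-component matters, since the multipliers of the other primes are
-- divisible by `p`. Membership in `D^p` and `D^{2*}` thus reduces to that of `γ` or `μ`.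
theorem exists_mixed_eq {p : ℕ} (hp : p.Prime) (hdvd : p ∣ Fintype.card D) (S : Finset ℕ) :
    ∃ z y : D, (z = γ ∨ z = μ) ∧ mixed γ μ S = padicMultiplier D p • z + p • y := by
  have hmem : p ∈ (Fintype.card D).primeFactors :=
    Nat.mem_primeFactors.2 ⟨hp, hdvd, Fintype.card_ne_zero⟩
  have hrest : ∑ p' ∈ (Fintype.card D).primeFactors.erase p,
      padicComponent p' (if p' ∈ S then μ else γ) ∈ (nsmulAddMonoidHom (α := D) p).range := by
    refine sum_mem fun p' hp' => ?_
    obtain ⟨t, ht⟩ := dvd_padicMultiplier (D := D) hp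
      (Nat.prime_of_mem_primeFactors (Finset.mem_of_mem_erase hp'))
      (Finset.ne_of_mem_erase hp').symm hdvd
    exact ⟨t • (if p' ∈ S then μ else γ), by rw [padicComponent_eq, ht, mul_nsmul']; rfl⟩
  obtain ⟨y, hy⟩ := hrest
  refine ⟨if p ∈ S then μ else γ, y, ?_, ?_⟩
  · split_ifs <;> simp
  · rw [mixed, ← Finset.add_sum_erase _ _ hmem, ← hy]; rfl

omit [DecidableEq D] in
theorem prime_dvd_card {p : ℕ} (hp : p.Prime) (hγ : γ ∉ mulImage D p) : p ∣ Fintype.card D := by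
  by_contra h
  have hc : (Nat.card D).Coprime p := by
    rw [Nat.card_eq_fintype_card]
    exact ((Nat.Prime.coprime_iff_not_dvd hp).2 h).symm
  exact hγ ⟨(nsmulCoprime hc).symm γ, (nsmulCoprime hc).apply_symm_apply γ⟩

omit [DecidableEq D] in
theorem mixed_notMem_mulImage {p : ℕ} (hp : p.Prime) (hγ : γ ∉ mulImage D p)
    (hμ : μ ∉ mulImage D p) (S : Finset ℕ) : mixed γ μ S ∉ mulImage D p := by
  rintro ⟨x, hx⟩
  obtain ⟨z, y, hz, h⟩ := exists_mixed_eq (γ := γ) (μ := μ) hp (prime_dvd_card hp hγ) S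
  have hzmem : z ∈ mulImage D p := by
    -- The multiplier is invertible modulo `p`, so if its product with `z` lies in `p D`, then so
    -- does `z`.
    obtain ⟨a, b, hab⟩ := Nat.isCoprime_iff_coprime.2 (coprime_padicMultiplier (D := D) hp)
    refine ⟨a • z + b • (x - y), ?_⟩
    rw [← natCast_zsmul] at hx h ⊢
    rw [← natCast_zsmul] at h
    have h1 : z = (a * p + b * padicMultiplier D p) • z := by rw [hab, one_smul]
    have h2 : (padicMultiplier D p : ℤ) • z = (p : ℤ) • (x - y) := by
      rw [smul_sub, hx, h, add_sub_cancel_right]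
    conv_rhs => rw [h1, add_smul, mul_smul b, h2]
    module
  rcases hz with rfl | rfl
  · exact hγ hzmem
  · exact hμ hzmem

omit [DecidableEq D] in
theorem mixed_notMem_starCoset (hdvd : 2 ∣ Fintype.card D) (hγ : γ ∉ 𝒟.starCoset 2)
    (hμ : μ ∉ 𝒟.starCoset 2) (S : Finset ℕ) : mixed γ μ S ∉ 𝒟.starCoset 2 := by
  intro hmem
  obtain ⟨z, y, hz, h⟩ := exists_mixed_eq (γ := γ) (μ := μ) Nat.prime_two hdvd S
  have hzmem : z ∈ 𝒟.starCoset 2 := by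
    intro a ha
    have h1 := hmem a ha
    -- The multiplier is odd and `2 (a, z) = 0`, so it acts trivially on `(a, z)`.
    obtain ⟨t, ht⟩ := (Nat.coprime_two_left (n := padicMultiplier D 2)).1
      (coprime_padicMultiplier Nat.prime_two)
    rw [h, bil_add_right, bil_nsmul_right, bil_nsmul_right, bil_comm 𝒟 a y,
      nsmul_bil_of_torsion 𝒟 ha, ht, add_nsmul, mul_nsmul, bil_comm 𝒟 a z,
      nsmul_bil_of_torsion 𝒟 ha, smul_zero, zero_add, one_nsmul, add_zero] at h1
    rwa [bil_comm 𝒟 a z]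
  rcases hz with rfl | rfl
  · exact hγ hzmem
  · exact hμ hzmem

theorem symVec_apply (β : D) :
    symVec γ μ P β = ∑ S ∈ P.powerset, (-1 : ℂ) ^ S.card * if mixed γ μ S = β then 1 else 0 := by
  simp [symVec, Finset.sum_apply, Pi.single_apply, eq_comm]

theorem isAdmissible_symVec (hP : ∀ p ∈ P, p.Prime) (hdiff : (∏ p ∈ P, p) • (γ - μ) = 0)
    (hq : 𝒟.q γ = 𝒟.q μ) (hγ : ∀ p ∈ P, γ ∉ mulImage D p) (hμ : ∀ p ∈ P, μ ∉ mulImage D p)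
    (h2 : 2 ∈ P → γ ∉ 𝒟.starCoset 2 ∧ μ ∉ 𝒟.starCoset 2) {p : ℕ} (hp : p ∈ P) :
    IsAdmissible 𝒟 p (symVec γ μ P) where
  mulImage x hx := by
    rw [symVec_apply]
    refine Finset.sum_eq_zero fun S _ => ?_
    rw [if_neg, mul_zero]
    rintro rfl
    exact mixed_notMem_mulImage (hP p hp) (hγ p hp) (hμ p hp) S hx
  starCoset := by
    rintro rfl x hx
    rw [symVec_apply]
    refine Finset.sum_eq_zero fun S _ => ?_
    rw [if_neg, mul_zero]
    rintro rfl
    exact mixed_notMem_starCoset (prime_dvd_card Nat.prime_two (hγ 2 hp)) (h2 hp).1 (h2 hp).2 S hx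
  sum_coset n δ := by
    -- At most one `ε` contributes for each `S`, and one does exactly when `γ_S^μ` lies in the
    -- `p`-torsion coset of `δ`.
    have h1 : ∀ S, ∑ ε ∈ torsion D p, e (n • 𝒟.q (δ + ε)) *
        ((-1 : ℂ) ^ S.card * if mixed γ μ S = δ + ε then 1 else 0) =
        (-1 : ℂ) ^ S.card * if p • mixed γ μ S = p • δ then e (n • 𝒟.q (mixed γ μ S)) else 0 := by
      intro S
      have h2 : ∀ ε ∈ torsion D p, e (n • 𝒟.q (δ + ε)) *
          ((-1 : ℂ) ^ S.card * if mixed γ μ S = δ + ε then 1 else 0) =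
          if mixed γ μ S - δ = ε then (-1 : ℂ) ^ S.card * e (n • 𝒟.q (mixed γ μ S)) else 0 := by
        intro ε _
        by_cases h : mixed γ μ S = δ + ε
        · rw [if_pos h, if_pos (by rw [h, add_sub_cancel_left]), h]; ring
        · rw [if_neg h, if_neg fun h' => h (by rw [← h', add_sub_cancel]), mul_zero, mul_zero]
      rw [Finset.sum_congr rfl h2, Finset.sum_ite_eq]
      simp only [mem_torsion, smul_sub, sub_eq_zero, mul_ite, mul_zero]
    simp only [symVec_apply, Finset.mul_sum]
    -- The subsets of `P` are grouped into pairs `S`, `S ∪ {p}` with `p ∉ S`, whose contributions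
    -- cancel.
    rw [Finset.sum_comm, Finset.sum_congr rfl fun S _ => h1 S, ← Finset.insert_erase hp,
      Finset.sum_powerset_insert (Finset.notMem_erase p P), ← Finset.sum_add_distrib]
    refine Finset.sum_eq_zero fun S hS => ?_
    have hpS : p ∉ S := fun h => Finset.notMem_erase p P (Finset.mem_powerset.1 hS h)
    rw [Finset.card_insert_of_notMem hpS, nsmul_mixed_insert hP hdiff hp, q_mixed hq, q_mixed hq]
    ring

/-- The coefficients of `v_{γ,μ,P}` are real, so the scalar product with it agrees with the bilinear
pairing that defines the annihilator. -/
theorem pairing_symVec (v : D → ℂ) :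
    pairing v (symVec γ μ P) = ∑ β, v β * symVec γ μ P β := by
  refine Finset.sum_congr rfl fun β _ => ?_
  rw [symVec_apply]
  simp [apply_ite]

end SymmetrizedVectors

end VVHecke

theorem mainTheorem11 {D : Type*} [AddCommGroup D] [Fintype D] [DecidableEq D]
    (𝒟 : VVHecke.DiscriminantForm D) {sgn : ℤ} (hsgn : 𝒟.HasSignature sgn) (heven : Even sgn)
    (k : ℤ) (P : Finset ℕ) (hP : ∀ p ∈ P, p.Prime) (γ μ : D)
    (hdiff : (∏ p ∈ P, p) • (γ - μ) = 0) (hq : 𝒟.q γ = 𝒟.q μ)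
    (hγ : ∀ p ∈ P, γ ∉ VVHecke.DiscriminantForm.mulImage D p)
    (hμ : ∀ p ∈ P, μ ∉ VVHecke.DiscriminantForm.mulImage D p)
    (h2 : 2 ∈ P → γ ∉ 𝒟.starCoset 2 ∧ μ ∉ 𝒟.starCoset 2)
    (s : ℂ) (f : UpperHalfPlane → D → ℂ)
    (hf : VVHecke.IsCuspForm (VVHecke.weilRep 𝒟 hsgn heven) k f)
    (ps : List ℕ) (hnodup : ps.Nodup) (hps : ps.toFinset = P) (g : UpperHalfPlane → D → ℂ)
    (hg : VVHecke.HasHeckeProduct (VVHecke.weilRep 𝒟 hsgn heven) k s ps f g)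
    (z : UpperHalfPlane) :
    VVHecke.pairing (g z) (VVHecke.symVec γ μ P) = VVHecke.pairing (f z) (VVHecke.symVec γ μ P) := by
  have hmem := hg.sub_mem_annihilator hsgn heven hP hf.slash_eq
    (fun p hp => hps ▸ List.mem_toFinset.2 hp) z
  have h := VVHecke.mem_annihilator.1 hmem (VVHecke.symVec γ μ P) fun p hp =>
    VVHecke.isAdmissible_symVec hP hdiff hq hγ hμ h2 hp
  rw [VVHecke.pairing_symVec, VVHecke.pairing_symVec, ← sub_eq_zero, ← Finset.sum_sub_distrib, ← h]
  exact Finset.sum_congr rfl fun β _ => (sub_mul _ _ _).symm
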